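/- Let $\Sigma$ be a finite alphabet with distinct symbols $0,1\in\Sigma$; $\Sigma^*$ (finite words) carries the discrete topology, $\Sigma^\omega$ (infinite sequences) the Cantor topology, products the product topology. A multi-function $f:A\rightrightarrows B$ is given by a subset of $A\times B$; $f(a)$ is the set of all $b$ related to $a$, and $\mathrm{dom}(f)=\{a: f(a)\neq\emptyset\}$; partial functions are the multi-functions with at most one value at each argument. For $Y_0,\dots,Y_n\in\{\Sigma^*,\Sigma^\omega\}$, a Type-2 machine of type $(Y_1,\dots,Y_n\to Y_0)$ is a Turing machine with $n$ read-only input tapes, finitely many work tapes and a one-way output tape. If $Y_0=\Sigma^*$ its result is the word on the output tape when it halts; if $Y_0=\Sigma^\omega$ its result is $p$ if it computes forever and writes $p$ on the output tape. A partial function from $Y_1\times\dots\times Y_n$ to $Y_0$ is called computable if some extension of it is the function computed by a Type-2 machine, and continuous if it is continuous on its domain. A surjective (i.e. every $z\in Z$ lies in some $\delta(p)$) multi-function $\delta:Y\rightrightarrows Z$ is called a multi-representation if $Y=\Sigma^\omega$ and a multi-notation if $Y=\Sigma^*$. Given such $\delta_j:Y_j\rightrightarrows Z_j$, a partial function $f$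 from $Y_1\times\dots\times Y_n$ to $Y_0$ realizes $g:Z_1\times\dots\times Z_n\rightrightarrows Z_0$ if, whenever $z_j\in\delta_j(y_j)$ for $1\le j\le n$ and $g(z_1,\dots,z_n)\neq\emptyset$, the value $f(y_1,\dots,y_n)$ exists and $g(z_1,\dots,z_n)\cap\delta_0(f(y_1,\dots,y_n))\neq\emptyset$. The multi-function $g$ is $(\delta_1,\dots,\delta_n,\delta_0)$-computable (-continuous) if it is realized by a computable (continuous) partial function. A generalized Turing machine $\mathbf P$ has tapes $0,\dots,L$ (tapes $1,\dots,k$, where $k\le L$, are the input tapes, tape $0$ is the output tape), a finite work alphabet $\Gamma$ with a blank, a set $Z_i$ disjoint from $\Gamma$ for each tape $i$, and a finite set of labels with an initial label $l_0$ and a final label $l_f$. The cells of tape $i$, indexed by $\mathbb Z$, hold elements of $Z_i\cup\Gamma$, and each tape has a head. Every label $l\ne l_f$ has one of the following statements: move the head on tape $i$ one cell to the right (left) and go to $l'$; write $a\in\Gamma$ on the scanned cell of tape $i$ and go to $l'$; go to $l'$ if $a\in\Gamma$ is scanned on tape $i$ and to $l''$ otherwise; "$i:=f(i_1,\dots,i_n)$,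 go to $l'$" for a multi-function $f:Z_{i_1}\times\dots\times Z_{i_n}\rightrightarrows Z_i$ (write some element of $f(x_{i_1},\dots,x_{i_n})$ on the scanned cell of tape $i$); "if $f(i_1,\dots,i_n)$ then $l'$ else $l''$" for a partial function $f$ from $Z_{i_1}\times\dots\times Z_{i_n}$ to $\{0,1\}\subseteq\Sigma^*$ (go to $l'$ if $f(x_{i_1},\dots,x_{i_n})=0$ and to $l''$ if it is $1$). Here $x_j$ is the content of the scanned cell of tape $j$; if a required value is not defined (in particular if some $x_{i_j}\notin Z_{i_j}$), the configuration has no successor. A configuration is accepting if its label is $l_f$ and cell $0$ of tape $0$ contains an element of $Z_0$. On input $(x_1,\dots,x_k)$ the machine starts with label $l_0$, all heads on cell $0$, $x_i$ in cell $0$ of tape $i$ for $1\le i\le k$, and blanks elsewhere. The multi-function $f_{\mathbf P}:Z_1\times\dots\times Z_k\rightrightarrows Z_0$ computed by $\mathbf P$ is defined by: $x_0\in f_{\mathbf P}(x_1,\dots,x_k)$ iff every maximal computation on this input is finite and ends in an accepting configuration, and some such computation ends with $x_0$ in cell $0$ of tape $0$. **Theorem.** Let $\mathbf P$ be a generalized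 Turing machine and for every tape $i$, $0\le i\le L$, let $\delta_i:Y_i\rightrightarrows Z_i$ be a multi-representation or a multi-notation, $Y_i\in\{\Sigma^*,\Sigma^\omega\}$ (the choice may differ from tape to tape). Suppose that every $f$ in an assignment "$i:=f(i_1,\dots,i_n)$" of $\mathbf P$ is $(\delta_{i_1},\dots,\delta_{i_n},\delta_i)$-computable and every $f$ in a branching "if $f(i_1,\dots,i_n)$ then … else …" of $\mathbf P$ is $(\delta_{i_1},\dots,\delta_{i_n},\mathrm{id}_{\Sigma^*})$-computable. Then $f_{\mathbf P}$ is $(\delta_1,\dots,\delta_k,\delta_0)$-computable. The same holds with "continuous" in place of "computable" throughout. -/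

import Mathlib

namespace TTE

/-! ## Multi-functions and realization

A multi-function `f : X ⇉ Y` is a map `f : X → Set Y`; its domain is the set of those `x` for which
`f x` is nonempty.  A partial function is a `PFun`. -/

/-- A partial function, viewed as a multi-function. -/
def toMulti {X Y : Type*} (f : X →. Y) : X → Set Y := fun x => {y | y ∈ f x}

/-- `δ : U ⇉ Z` is a (generalized) multi-representation of `Z`: its range is all of `Z`. -/
def IsMultiRep {U Z : Type*} (δ : U → Set Z) : Prop := ∀ z, ∃ u, z ∈ δ u

/-- `f : X₁ × ⋯ × Xₙ ⇉ X₀` realizes `g : Y₁ × ⋯ × Yₙ ⇉ Y₀` via `(γ₁, …, γₙ, γ₀)`. -/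
def Realizes {n : ℕ} {X Y : Fin n → Type*} {X₀ Y₀ : Type*}
    (γ : ∀ j, X j → Set (Y j)) (γ₀ : X₀ → Set Y₀)
    (f : (∀ j, X j) → Set X₀) (g : (∀ j, Y j) → Set Y₀) : Prop :=
  ∀ (x : ∀ j, X j) (y : ∀ j, Y j), (∀ j, y j ∈ γ j (x j)) → (g y).Nonempty →
    (f x).Nonempty ∧ ∀ x₀ ∈ f x, (g y ∩ γ₀ x₀).Nonempty

/-! ## Finite and infinite words as names -/

/-- The two possible kinds of names: finite words and infinite sequences. -/
inductive NameKind
  | word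
  | seq

/-- The set of names of a given kind over the alphabet `A`. -/
def Names (A : Type*) : NameKind → Type _
  | .word => List A
  | .seq => ℕ → A

/-- Discrete topology on finite words, Cantor topology (the product of the discrete topologies) on
infinite sequences. -/
instance Names.topologicalSpace (A : Type*) : (κ : NameKind) → TopologicalSpace (Names A κ)
  | .word => (⊥ : TopologicalSpace (List A))
  | .seq => @Pi.topologicalSpace ℕ (fun _ => A) (fun _ => ⊥)

/-- The content of cell `m` of an input tape on which a name is written; the cells to the right of
a finite word are blank (`none`). -/
def Names.cell {A : Type*} : {κ : NameKind} → Names A κ → ℕ → Option A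
  | .word, w, m => (show List A from w)[m]?
  | .seq, p, m => some (p m)

/-! ## Type-2 machines -/

/-- What a Type-2 machine with `k` input tapes and `w` work tapes does in one step. -/
structure Type2Action (A : Type*) (k w : ℕ) (Q S : Type*) where
  /-- the next state -/
  next : Q
  /-- movements of the heads on the read-only input tapes (`none`: no movement) -/
  inputMove : Fin k → Option Turing.Dir
  /-- symbols written on the scanned cells of the work tapes -/
  write : Fin w → S
  /-- movements of the heads on the work tapes, after writing -/
  workMove : Fin w → Option Turing.Dir
  /-- the symbol appended to the content of the one-way output tape, if any -/
  out : Option A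

/-- A Type-2 machine over the alphabet `A`: a Turing machine with `k` read-only input tapes,
finitely many work tapes and a one-way output tape. -/
structure Type2Machine (A : Type*) (k : ℕ) where
  /-- states -/
  Q : Type
  [finQ : Finite Q]
  /-- work alphabet, with `default` as blank symbol -/
  S : Type
  [finS : Finite S]
  [inhS : Inhabited S]
  /-- number of work tapes -/
  w : ℕ
  /-- initial state -/
  start : Q
  /-- The program. The next action depends on the state and the symbols scanned by the heads on the
  input tapes and the work tapes; `none` means that the machine halts. -/
  prog : Q → (Fin k → Option A) → (Fin w → S) → Option (Type2Action A k w Q S)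

namespace Type2Machine

attribute [instance] finQ finS inhS

variable {A : Type*} {k : ℕ}

/-- Configurations. The input tapes are one-sided infinite, with cells `0, 1, 2, …`. -/
structure Cfg (M : Type2Machine A k) where
  /-- state -/
  state : M.Q
  /-- head positions on the input tapes -/
  pos : Fin k → ℕ
  /-- the work tapes with their heads -/
  work : Fin M.w → Turing.Tape M.S
  /-- the word that has been written on the output tape -/
  output : List A

/-- Movement of a head on an input tape; at the left end a movement to the left has no effect. -/
def moveInput : Option Turing.Dir → ℕ → ℕ
  | none, m => m
  | some .left, m => m - 1
  | some .right, m => m + 1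

/-- Movement of a head on a work tape. -/
def moveWork {S : Type*} [Inhabited S] : Option Turing.Dir → Turing.Tape S → Turing.Tape S
  | none, T => T
  | some d, T => T.move d

/-- One step on an input `x`; the result is `none` if the machine halts. -/
def step (M : Type2Machine A k) {κ : Fin k → NameKind} (x : ∀ j, Names A (κ j)) (c : M.Cfg) :
    Option M.Cfg :=
  (M.prog c.state (fun j => (x j).cell (c.pos j)) (fun j => (c.work j).head)).map fun a =>
    { state := a.next
      pos := fun j => moveInput (a.inputMove j) (c.pos j)
      work := fun j => moveWork (a.workMove j) ((c.work j).write (a.write j))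
      output := c.output ++ a.out.toList }

/-- The initial configuration: heads on the first cells, work tapes blank, output tape empty. -/
def init (M : Type2Machine A k) : M.Cfg where
  state := M.start
  pos := fun _ => 0
  work := fun _ => default
  output := []

/-- The graph of the function `f_M : Y₁ × ⋯ × Y_k → Y₀` computed by `M` under the type
specification `(κ, κ₀)`: for words as results, `M` halts with the result on the output tape; for
sequences as results, `M` computes forever and writes the result on the output tape, that is, every
symbol of the result is written at some time. -/
def Computes (M : Type2Machine A k) {κ : Fin k → NameKind} (x : ∀ j, Names A (κ j)) :
    {κ₀ : NameKind} → Names A κ₀ → Prop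
  | .word, v => ∃ c, StateTransition.Reaches (M.step x) M.init c ∧ M.step x c = none ∧ c.output = v
  | .seq, p => ∀ m, ∃ c, StateTransition.Reaches (M.step x) M.init c ∧ c.output[m]? = some (p m)

end Type2Machine

section Computability

variable {A : Type*} {n : ℕ} {κ : Fin n → NameKind} {κ₀ : NameKind}

/-- `f = f_M` for some Type-2 machine `M`. -/
def TuringComputable (f : (∀ j, Names A (κ j)) →. Names A κ₀) : Prop :=
  ∃ M : Type2Machine A n, ∀ x y, y ∈ f x ↔ M.Computes x y

/-- `f` has a Turing computable extension. -/
def IsComputable (f : (∀ j, Names A (κ j)) →. Names A κ₀) : Prop :=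
  ∃ g : (∀ j, Names A (κ j)) →. Names A κ₀, TuringComputable g ∧ ∀ x, ∀ y ∈ f x, y ∈ g x

/-- `f` is continuous on its domain (with the subspace topology). -/
def IsContinuous (f : (∀ j, Names A (κ j)) →. Names A κ₀) : Prop :=
  Continuous f.asSubtype

variable {Z : Fin n → Type*} {Z₀ : Type*}

/-- The multi-function `g` is `(δ₁, …, δₙ, δ₀)`-computable: it has a computable realization. -/
def RelComputable (δ : ∀ j, Names A (κ j) → Set (Z j)) (δ₀ : Names A κ₀ → Set Z₀)
    (g : (∀ j, Z j) → Set Z₀) : Prop :=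
  ∃ f : (∀ j, Names A (κ j)) →. Names A κ₀, IsComputable f ∧ Realizes δ δ₀ (toMulti f) g

/-- The multi-function `g` is `(δ₁, …, δₙ, δ₀)`-continuous: it has a continuous realization. -/
def RelContinuous (δ : ∀ j, Names A (κ j) → Set (Z j)) (δ₀ : Names A κ₀ → Set Z₀)
    (g : (∀ j, Z j) → Set Z₀) : Prop :=
  ∃ f : (∀ j, Names A (κ j)) →. Names A κ₀, IsContinuous f ∧ Realizes δ δ₀ (toMulti f) g

end Computability

/-- The identity on finite words, as a multi-notation of the set of finite words. -/
def idWord (A : Type*) : Names A .word → Set (List A) := fun w => {v | v = w}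

/-! ## Generalized Turing machines -/

/-- Statements with labels in `Lab` and work alphabet `Γ`, for the tapes `0, …, L` with the sets
`X i`. In a branching, the word `0` means true and the word `1` means false. -/
inductive Stmt (A : Type*) [Zero A] [One A] (Lab Γ : Type) {L : ℕ} (X : Fin (L + 1) → Type*)
  /-- `(i, right, l')` -/
  | right (i : Fin (L + 1)) (l' : Lab)
  /-- `(i, left, l')` -/
  | left (i : Fin (L + 1)) (l' : Lab)
  /-- `(i := a, l')` -/
  | write (i : Fin (L + 1)) (a : Γ) (l' : Lab)
  /-- `(i, if a then l', else l'')` -/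
  | test (i : Fin (L + 1)) (a : Γ) (l' l'' : Lab)
  /-- `(i := f(i₁, …, iₙ), l')` with a multi-function `f` -/
  | assign (i : Fin (L + 1)) (n : ℕ) (idx : Fin n → Fin (L + 1))
      (f : (∀ j, X (idx j)) → Set (X i)) (l' : Lab)
  /-- `(if f(i₁, …, iₙ) then l', else l'')` with a partial function `f` into `{0, 1}` -/
  | branch (n : ℕ) (idx : Fin n → Fin (L + 1)) (f : (∀ j, X (idx j)) →. List A)
      (hf : ∀ x, ∀ v ∈ f x, v = [0] ∨ v = [1]) (l' l'' : Lab)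

/-- Generalized Turing machines over the alphabet `A`. -/
structure GTM (A : Type*) [Zero A] [One A] where
  /-- labels -/
  Lab : Type
  [finLab : Finite Lab]
  /-- initial label -/
  l₀ : Lab
  /-- final label -/
  lf : Lab
  /-- work alphabet -/
  Γ : Type
  [finΓ : Finite Γ]
  /-- blank symbol -/
  b : Γ
  /-- number of input tapes -/
  k : ℕ
  /-- the tapes are `0, …, L` -/
  L : ℕ
  hk : k ≤ L
  /-- The sets assigned to the tapes; the cells of tape `i` hold elements of the disjoint union
  `X i ⊕ Γ`. -/
  X : Fin (L + 1) → Type*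
  /-- the statement of each non-final label -/
  stm : {l : Lab // l ≠ lf} → Stmt A Lab Γ X

namespace GTM

variable {A : Type*} [Zero A] [One A]

/-- The number of the `j`-th input tape: the input tapes are `1, …, k`. -/
def inTape (P : GTM A) (j : Fin P.k) : Fin (P.L + 1) := (Fin.castLE P.hk j).succ

/-- Configurations. -/
structure Cfg (P : GTM A) where
  /-- current label -/
  label : P.Lab
  /-- tape inscriptions -/
  tape : ∀ i, ℤ → P.X i ⊕ P.Γ
  /-- head positions -/
  head : Fin (P.L + 1) → ℤ

variable {P : GTM A}

/-- The content of the cell scanned by the head on tape `i`. -/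
def Cfg.scanned (c : P.Cfg) (i : Fin (P.L + 1)) : P.X i ⊕ P.Γ := c.tape i (c.head i)

/-- Change the label. -/
def Cfg.setLabel (c : P.Cfg) (l : P.Lab) : P.Cfg := { c with label := l }

/-- Move the head on tape `i` to position `m`. -/
def Cfg.setHead (c : P.Cfg) (i : Fin (P.L + 1)) (m : ℤ) : P.Cfg :=
  { c with head := Function.update c.head i m }

/-- Write `x` under the head of tape `i`. -/
def Cfg.setCell (c : P.Cfg) (i : Fin (P.L + 1)) (x : P.X i ⊕ P.Γ) : P.Cfg :=
  { c with tape := Function.update c.tape i (Function.update (c.tape i) (c.head i) x) }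

/-- The effect of a statement: `c'` is a possible result of executing it in `c`. -/
def Exec : Stmt A P.Lab P.Γ P.X → P.Cfg → P.Cfg → Prop
  | .right i l', c, c' => c' = (c.setHead i (c.head i + 1)).setLabel l'
  | .left i l', c, c' => c' = (c.setHead i (c.head i - 1)).setLabel l'
  | .write i a l', c, c' => c' = (c.setCell i (.inr a)).setLabel l'
  | .test i a l' l'', c, c' =>
      (c.scanned i = .inr a ∧ c' = c.setLabel l') ∨ (c.scanned i ≠ .inr a ∧ c' = c.setLabel l'')
  | .assign i n idx f l', c, c' =>
      ∃ x : ∀ j : Fin n, P.X (idx j), (∀ j, c.scanned (idx j) = .inl (x j)) ∧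
        ∃ y ∈ f x, c' = (c.setCell i (.inl y)).setLabel l'
  | .branch n idx f _ l' l'', c, c' =>
      ∃ x : ∀ j : Fin n, P.X (idx j), (∀ j, c.scanned (idx j) = .inl (x j)) ∧
        (([0] ∈ f x ∧ c' = c.setLabel l') ∨ ([1] ∈ f x ∧ c' = c.setLabel l''))

/-- The successor relation `⊢` on configurations. -/
def Step (c c' : P.Cfg) : Prop := ∃ h : c.label ≠ P.lf, Exec (P.stm ⟨c.label, h⟩) c c'

/-- Accepting configurations. -/
def Cfg.Accepting (c : P.Cfg) : Prop := c.label = P.lf ∧ ∃ y, c.tape 0 0 = .inl y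

/-- The initial configuration: the input `x j` is in cell `0` of the `j`-th input tape, all other
cells are blank, all heads are on position `0`. -/
def init (x : ∀ j, P.X (P.inTape j)) : P.Cfg where
  label := P.l₀
  tape := fun i => Fin.cases (motive := fun i => ℤ → P.X i ⊕ P.Γ) (fun _ => .inr P.b)
    (fun i m => if h : i.val < P.k ∧ m = 0 then .inl (x ⟨i.val, h.1⟩) else .inr P.b) i
  head := fun _ => 0

/-- Every maximal computation with first configuration `c` is accepting: there is no infinite
computation from `c`, and every finite computation from `c` whose last configuration has no
successor ends with an accepting configuration. -/
def AllAccepting (c : P.Cfg) : Prop :=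
  (¬ ∃ s : ℕ → P.Cfg, s 0 = c ∧ ∀ m, Step (s m) (s (m + 1))) ∧
    ∀ d, Relation.ReflTransGen Step c d → (¬ ∃ d', Step d d') → d.Accepting

variable (P)

/-- The multi-function `f_P : X₁ × ⋯ × X_k ⇉ X₀` computed by the machine `P`. -/
def fn (x : ∀ j, P.X (P.inTape j)) : Set (P.X 0) :=
  {y | AllAccepting (init x) ∧
    ∃ d, Relation.ReflTransGen Step (init x) d ∧ d.Accepting ∧ d.tape 0 0 = .inl y}

/-- All functions in the statements of `P` are computable with respect to the `δ i`. -/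
def RelComputable {κ : Fin (P.L + 1) → NameKind} (δ : ∀ i, Names A (κ i) → Set (P.X i)) : Prop :=
  ∀ l, match P.stm l with
    | .assign i _ idx f _ => TTE.RelComputable (fun j => δ (idx j)) (δ i) f
    | .branch _ idx f _ _ _ => TTE.RelComputable (fun j => δ (idx j)) (idWord A) (toMulti f)
    | _ => True

/-- All functions in the statements of `P` are continuous with respect to the `δ i`. -/
def RelContinuous {κ : Fin (P.L + 1) → NameKind} (δ : ∀ i, Names A (κ i) → Set (P.X i)) : Prop :=
  ∀ l, match P.stm l with
    | .assign i _ idx f _ => TTE.RelContinuous (fun j => δ (idx j)) (δ i) f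
    | .branch _ idx f _ _ _ => TTE.RelContinuous (fun j => δ (idx j)) (idWord A) (toMulti f)
    | _ => True

end GTM

end TTE

/-!
A realizer on names is *tracked* by a function on finite approximations of names if the values at
the successive approximations of the arguments converge to the result. A function of names is
continuous iff it is tracked, and it has a computable extension iff it is tracked by a primitive
recursive function: the output after `t` steps of a Type-2 machine is primitive recursive in the
approximations, and conversely, a machine may read one more symbol of every input tape per stage
and evaluate, on its work tapes, a program for the tracking function at what it has read.

Replacing the functions of a generalized Turing machine by realizers yields a single-valued machine
on names whose results realize the multi-function of the original machine. Running it for `t` steps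
on stage-`t` approximations, where an assignment is carried out by tracking and the run stops at a
branching whose test is not yet decided, tracks these results: every finite computation is
eventually followed exactly. If all statements are tracked by primitive recursive functions, then
so are the results.
-/

namespace TTE

open Filter
open StateTransition (Reaches)

/-! ## Approximations of names -/

/-- A finite approximation of a name: the contents of finitely many of its first cells. -/
abbrev Approx (A : Type*) := List (Option A)

/-- A function of `n` approximations of names. The additional argument is a bound on the amount of
information that it may use, which is thought of as time. -/
abbrev ApproxFn (A : Type*) (n : ℕ) := ℕ → (Fin n → Approx A) → Approx A

section Approximations

variable {A : Type*} {n : ℕ} {κ : Fin n → NameKind} {κ₀ : NameKind}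

/-- The content of the first `t` cells of a name. -/
def Names.take (y : Names A κ₀) (t : ℕ) : Approx A := (List.range t).map y.cell

/-- The approximation `a` is correct for `y`. -/
def Approximates (a : Approx A) (y : Names A κ₀) : Prop := ∀ m v, a[m]? = some v → y.cell m = v

/-- The approximations `a 0, a 1, …` are correct for `y` and eventually determine each cell. The
lengths need not be monotone. -/
structure ConvergesTo (a : ℕ → Approx A) (y : Names A κ₀) : Prop where
  approximates : ∀ t, Approximates (a t) y
  eventually_lt_length : ∀ m, ∀ᶠ t in atTop, m < (a t).length

/-- `h` computes approximations of the values of `f` from approximations of the arguments. -/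
def Tracks (h : ApproxFn A n) (f : (∀ j, Names A (κ j)) → Set (Names A κ₀)) : Prop :=
  ∀ x, ∀ y ∈ f x, ∀ a : ℕ → Fin n → Approx A, (∀ j, ConvergesTo (fun t => a t j) (x j)) →
    ConvergesTo (fun t => h t (a t)) y

theorem Names.cell_injective : ∀ {κ₀ : NameKind},
    Function.Injective (Names.cell : Names A κ₀ → ℕ → Option A)
  | .word, _, _, h => List.ext_getElem? fun m => congrFun h m
  | .seq, _, _, h => funext fun m => Option.some_injective _ (congrFun h m)

theorem Names.length_take (y : Names A κ₀) (t : ℕ) : (y.take t).length = t := by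
  simp [Names.take]

theorem Names.take_succ (y : Names A κ₀) (t : ℕ) : y.take (t + 1) = y.take t ++ [y.cell t] := by
  simp [Names.take, List.range_succ]

theorem Names.take_eq_take_iff {y y' : Names A κ₀} {t : ℕ} :
    y.take t = y'.take t ↔ ∀ m < t, y.cell m = y'.cell m := by
  simp [Names.take]

theorem Names.getElem?_take_of_lt (y : Names A κ₀) {m t : ℕ} (h : m < t) :
    (y.take t)[m]? = some (y.cell m) := by
  simp [Names.take, h]

theorem Names.approximates_take (y : Names A κ₀) (t : ℕ) : Approximates (y.take t) y := by
  intro m v h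
  have hm : m < t := by simpa only [y.length_take] using (List.getElem?_eq_some_iff.1 h).1
  exact Option.some_injective _ ((y.getElem?_take_of_lt hm).symm.trans h)

theorem Names.convergesTo_take (y : Names A κ₀) : ConvergesTo y.take y where
  approximates := y.approximates_take
  eventually_lt_length m := by simpa only [Names.length_take] using eventually_gt_atTop m

theorem Approximates.getElem? {a : Approx A} {y : Names A κ₀} (h : Approximates a y) {m : ℕ}
    (hm : m < a.length) : a[m]? = some (y.cell m) := by
  rw [List.getElem?_eq_getElem hm, h m _ (List.getElem?_eq_getElem hm)]

theorem Approximates.take_eq {a : Approx A} {y y' : Names A κ₀} (h : Approximates a y)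
    (h' : Approximates a y') {k : ℕ} (hk : k ≤ a.length) : y.take k = y'.take k :=
  Names.take_eq_take_iff.2 fun m hm => h m _ (h'.getElem? (hm.trans_le hk))

theorem ConvergesTo.eventually_getElem? {a : ℕ → Approx A} {y : Names A κ₀} (h : ConvergesTo a y)
    (m : ℕ) : ∀ᶠ t in atTop, (a t)[m]? = some (y.cell m) :=
  (h.eventually_lt_length m).mono fun t => (h.approximates t).getElem?

theorem ConvergesTo.unique {a : ℕ → Approx A} {y y' : Names A κ₀} (h : ConvergesTo a y)
    (h' : ConvergesTo a y') : y = y' := by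
  refine Names.cell_injective (funext fun m => ?_)
  obtain ⟨t, ht⟩ := (h'.eventually_getElem? m).exists
  exact h.approximates t m _ ht

theorem ConvergesTo.congr' {a b : ℕ → Approx A} {y : Names A κ₀} (h : ConvergesTo a y)
    (hb : ∀ t, Approximates (b t) y) (hab : b =ᶠ[atTop] a) : ConvergesTo b y where
  approximates := hb
  eventually_lt_length m := by
    filter_upwards [h.eventually_lt_length m, hab] with t ht hbt
    rwa [hbt]

theorem Tracks.unique {h : ApproxFn A n} {f : (∀ j, Names A (κ j)) → Set (Names A κ₀)}
    (hf : Tracks h f) {x y y'} (hy : y ∈ f x) (hy' : y' ∈ f x) : y = y' :=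
  (hf x y hy _ fun j => (x j).convergesTo_take).unique
    (hf x y' hy' _ fun j => (x j).convergesTo_take)

theorem Tracks.mono {h : ApproxFn A n} {f g : (∀ j, Names A (κ j)) → Set (Names A κ₀)}
    (hg : Tracks h g) (hfg : ∀ x, f x ⊆ g x) : Tracks h f :=
  fun x y hy => hg x y (hfg x hy)

end Approximations

/-! ## Continuity in terms of approximations -/

section Continuity

variable {A : Type*} {n : ℕ} {κ : Fin n → NameKind} {κ₀ : NameKind}

theorem Names.eq_of_take_length_succ_eq {v w : Names A .word}
    (h : v.take (List.length (α := A) w + 1) = w.take (List.length (α := A) w + 1)) : v = w := by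
  rw [Names.take_eq_take_iff] at h
  have hlen : List.length (α := A) v ≤ List.length (α := A) w :=
    List.getElem?_eq_none_iff.1 ((h _ (Nat.lt_succ_self _)).trans (List.getElem?_eq_none le_rfl))
  refine Names.cell_injective (funext fun m => ?_)
  rcases Nat.lt_or_ge m (List.length (α := A) w) with hm | hm
  · exact h m (hm.trans (Nat.lt_succ_self _))
  · exact (List.getElem?_eq_none (hlen.trans hm)).trans (List.getElem?_eq_none hm).symm

theorem Names.nhds_hasBasis : ∀ {κ₀ : NameKind} (y : Names A κ₀),
    (nhds y).HasBasis (fun _ : ℕ => True) fun t => {y' | y'.take t = y.take t}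
  | .word, w => by
    have : DiscreteTopology (Names A .word) := ⟨rfl⟩
    refine ⟨fun s => ?_⟩
    rw [nhds_discrete, mem_pure]
    refine ⟨fun hs => ⟨List.length (α := A) w + 1, trivial, fun v hv => ?_⟩,
      fun ⟨t, _, ht⟩ => ht rfl⟩
    rwa [Names.eq_of_take_length_succ_eq hv]
  | .seq, p => by
    let _ : TopologicalSpace A := ⊥
    have : DiscreteTopology A := ⟨rfl⟩
    have take_eq_iff (p' : Names A .seq) (t : ℕ) :
        p'.take t = p.take t ↔ p' ∈ PiNat.cylinder (E := fun _ => A) p t :=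
      Names.take_eq_take_iff.trans (forall₂_congr fun m _ => Option.some_inj)
    refine ⟨fun s => ((PiNat.isTopologicalBasis_cylinders fun _ => A).mem_nhds_iff).trans ?_⟩
    simp only [take_eq_iff, true_and]
    constructor
    · rintro ⟨_, ⟨q, t, rfl⟩, hp, hs⟩
      exact ⟨t, (PiNat.mem_cylinder_iff_eq.1 hp).subset.trans hs⟩
    · rintro ⟨t, hs⟩
      exact ⟨_, ⟨p, t, rfl⟩, PiNat.self_mem_cylinder p t, hs⟩

theorem Names.nhds_pi_hasBasis (x : ∀ j, Names A (κ j)) :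
    (nhds x).HasBasis (fun _ : ℕ => True) fun t => {x' | ∀ j, (x' j).take t = (x j).take t} := by
  refine ⟨fun s => ?_⟩
  rw [nhds_pi, (hasBasis_pi fun j => Names.nhds_hasBasis (x j)).mem_iff]
  constructor
  · rintro ⟨⟨I, N⟩, -, hs⟩
    refine ⟨Finset.univ.sup N, trivial, fun x' hx' => hs fun j _ => ?_⟩
    exact Names.take_eq_take_iff.2 fun m hm => Names.take_eq_take_iff.1 (hx' j) m
      (hm.trans_le (Finset.le_sup (Finset.mem_univ j)))
  · rintro ⟨N, -, hs⟩
    exact ⟨⟨Set.univ, fun _ => N⟩, ⟨Set.finite_univ, fun _ _ => trivial⟩,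
      fun x' hx' => hs fun j => hx' j trivial⟩

theorem isContinuous_iff {f : (∀ j, Names A (κ j)) →. Names A κ₀} :
    IsContinuous f ↔ ∀ x, ∀ y ∈ f x, ∀ k, ∃ N, ∀ x', ∀ y' ∈ f x',
      (∀ j, (x' j).take N = (x j).take N) → y'.take k = y.take k := by
  have continuousAt_iff (s : f.Dom) : ContinuousAt f.asSubtype s ↔ ∀ k, ∃ N, ∀ s' : f.Dom,
      (∀ j, (s'.1 j).take N = (s.1 j).take N) →
        (f.asSubtype s').take k = (f.asSubtype s).take k := by
    rw [ContinuousAt, nhds_subtype, ((Names.nhds_pi_hasBasis s.1).comap _).tendsto_iff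
      (Names.nhds_hasBasis _)]
    simp
  have exists_asSubtype_eq {x y} (hy : y ∈ f x) : ∃ hx : x ∈ f.Dom, f.asSubtype ⟨x, hx⟩ = y :=
    ⟨Part.dom_iff_mem.2 ⟨y, hy⟩, Part.mem_unique (Part.get_mem _) hy⟩
  simp only [IsContinuous, continuous_iff_continuousAt, continuousAt_iff]
  constructor
  · intro h x y hy k
    obtain ⟨hx, rfl⟩ := exists_asSubtype_eq hy
    obtain ⟨N, hN⟩ := h ⟨x, hx⟩ k
    refine ⟨N, fun x' y' hy' hxx' => ?_⟩
    obtain ⟨hx', rfl⟩ := exists_asSubtype_eq hy'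
    exact hN ⟨x', hx'⟩ hxx'
  · intro h s k
    obtain ⟨N, hN⟩ := h s.1 (f.asSubtype s) (Part.get_mem _) k
    exact ⟨N, fun s' hs' => hN s'.1 _ (Part.get_mem _) hs'⟩

theorem isContinuous_of_tracks {h : ApproxFn A n} {f : (∀ j, Names A (κ j)) →. Names A κ₀}
    (hf : Tracks h (toMulti f)) : IsContinuous f := by
  refine isContinuous_iff.2 fun x y hy k => ?_
  have hxy := hf x y hy _ fun j => (x j).convergesTo_take
  obtain ⟨N, hN⟩ := (hxy.eventually_lt_length k).exists
  refine ⟨N, fun x' y' hy' hx' => ?_⟩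
  have hxy' := (hf x' y' hy' _ fun j => (x' j).convergesTo_take).approximates N
  simp only [hx'] at hxy'
  exact hxy'.take_eq (hxy.approximates N) hN.le

/-- All names in `S` have the same first `k` cells. -/
def AgreeBelow (S : Set (Names A κ₀)) (k : ℕ) : Prop := ∀ y ∈ S, ∀ y' ∈ S, y.take k = y'.take k

open Classical in
/-- The longest approximation of length at most `t` that is common to all names in `S`. -/
noncomputable def commonPrefix (S : Set (Names A κ₀)) (t : ℕ) : Approx A :=
  if h : S.Nonempty then h.some.take (Nat.findGreatest (AgreeBelow S) t) else []

theorem approximates_commonPrefix {S : Set (Names A κ₀)} {y : Names A κ₀} (hy : y ∈ S) (t : ℕ) :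
    Approximates (commonPrefix S t) y := by
  classical
  have hne : S.Nonempty := ⟨y, hy⟩
  have hagree : AgreeBelow S (Nat.findGreatest (AgreeBelow S) t) :=
    Nat.findGreatest_spec (Nat.zero_le t) fun _ _ _ _ => rfl
  rw [commonPrefix, dif_pos hne, hagree _ hne.some_mem y hy]
  exact y.approximates_take _

theorem le_length_commonPrefix {S : Set (Names A κ₀)} (hne : S.Nonempty) {k t : ℕ}
    (hk : AgreeBelow S k) (hkt : k ≤ t) : k ≤ (commonPrefix S t).length := by
  classical
  rw [commonPrefix, dif_pos hne, Names.length_take]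
  exact Nat.le_findGreatest hkt hk

/-- The values of `f` at the arguments for which the approximations `a` are correct. -/
def compatibleValues (f : (∀ j, Names A (κ j)) →. Names A κ₀) (a : Fin n → Approx A) :
    Set (Names A κ₀) :=
  {y | ∃ x, y ∈ f x ∧ ∀ j, Approximates (a j) (x j)}

theorem tracks_commonPrefix_compatibleValues {f : (∀ j, Names A (κ j)) →. Names A κ₀}
    (hf : IsContinuous f) :
    Tracks (fun t a => commonPrefix (compatibleValues f a) t) (toMulti f) := by
  intro x y hy a ha
  have hmem (t : ℕ) : y ∈ compatibleValues f (a t) := ⟨x, hy, fun j => (ha j).approximates t⟩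
  refine ⟨fun t => approximates_commonPrefix (hmem t) t, fun m => ?_⟩
  obtain ⟨N, hN⟩ := isContinuous_iff.1 hf x y hy (m + 1)
  filter_upwards [eventually_all.2 fun j => (ha j).eventually_lt_length N, eventually_gt_atTop m]
    with t hlen hmt
  have take_eq : ∀ y' ∈ compatibleValues f (a t), y'.take (m + 1) = y.take (m + 1) := by
    rintro y' ⟨x', hy', hx'⟩
    exact hN x' y' hy' fun j => (hx' j).take_eq ((ha j).approximates t) (hlen j).le
  exact le_length_commonPrefix ⟨y, hmem t⟩
    (fun y₁ h₁ y₂ h₂ => (take_eq y₁ h₁).trans (take_eq y₂ h₂).symm) hmt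

end Continuity

/-! ## Replacing objects by names in a generalized Turing machine -/

section Realization

variable {A : Type*} [Zero A] [One A]

/-- The statement on names, given second, results from the statement on objects by replacing its
function, if there is one, by a realization. -/
inductive StmtRealizes {Lab Γ : Type} {L : ℕ} {X : Fin (L + 1) → Type*}
    {κ : Fin (L + 1) → NameKind} (δ : ∀ i, Names A (κ i) → Set (X i)) :
    Stmt A Lab Γ X → Stmt A Lab Γ (fun i => Names A (κ i)) → Prop
  | right (i l') : StmtRealizes δ (.right i l') (.right i l')
  | left (i l') : StmtRealizes δ (.left i l') (.left i l')
  | write (i a l') : StmtRealizes δ (.write i a l') (.write i a l')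
  | test (i a l' l'') : StmtRealizes δ (.test i a l' l'') (.test i a l' l'')
  | assign (i n idx f g l') (h : Realizes (fun j => δ (idx j)) (δ i) g f) :
      StmtRealizes δ (.assign i n idx f l') (.assign i n idx g l')
  | branch (n idx f hf g hg l' l'')
      (h : Realizes (fun j => δ (idx j)) (idWord A) (toMulti g) (toMulti f)) :
      StmtRealizes δ (.branch n idx f hf l' l'') (.branch n idx g hg l' l'')

namespace GTM

/-- The machine with the same tapes, labels and work alphabet as `P` whose sets consist of names and
whose program is `stm'`. -/
abbrev onNames (P : GTM A) {κ : Fin (P.L + 1) → NameKind}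
    (stm' : {l : P.Lab // l ≠ P.lf} → Stmt A P.Lab P.Γ fun i => Names A (κ i)) : GTM A :=
  { P with X := fun i => Names A (κ i), stm := stm' }

/-- The results of the accepting computations of `P`. In contrast to `GTM.fn`, there may also be
computations that do not accept. -/
def results (P : GTM A) (x : ∀ j, P.X (P.inTape j)) : Set (P.X 0) :=
  {y | ∃ d, Relation.ReflTransGen Step (init x) d ∧ d.label = P.lf ∧ d.tape 0 0 = .inl y}

theorem AllAccepting.step {P : GTM A} {c d : P.Cfg} (h : AllAccepting c) (hs : Step c d) :
    AllAccepting d := by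
  refine ⟨fun ⟨s, hs₀, hstep⟩ => h.1 ⟨fun m => Nat.casesOn m c s, rfl, fun m => ?_⟩,
    fun e he => h.2 e (.head hs he)⟩
  cases m with
  | zero => simpa [hs₀] using hs
  | succ m => exact hstep m

theorem AllAccepting.exists_step {P : GTM A} {c : P.Cfg} (h : AllAccepting c)
    (hc : c.label ≠ P.lf) : ∃ d, Step c d :=
  by_contra fun hn => hc (h.2 c .refl hn).1

theorem AllAccepting.acc {P : GTM A} {c : P.Cfg} (h : AllAccepting c) :
    Acc (fun d c : P.Cfg => Step c d) c :=
  by_contra fun hn => h.1 (not_acc_iff_exists_descending_chain.1 hn)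

theorem AllAccepting.exists_result {P : GTM A} {c d : P.Cfg} (h : AllAccepting c)
    (hd : Relation.ReflTransGen Step c d) (hl : d.label = P.lf) : ∃ y, d.tape 0 0 = .inl y :=
  (h.2 d hd fun ⟨_, hne, _⟩ => hne hl).2

variable {P : GTM A} {κ : Fin (P.L + 1) → NameKind} {δ : ∀ i, Names A (κ i) → Set (P.X i)}
  {stm' : {l : P.Lab // l ≠ P.lf} → Stmt A P.Lab P.Γ fun i => Names A (κ i)}

/-- The configuration `c` results from `c'` by replacing each name by an object that it denotes. -/
structure IsNamed (δ : ∀ i, Names A (κ i) → Set (P.X i)) (c' : (P.onNames stm').Cfg) (c : P.Cfg) :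
    Prop where
  label : c'.label = c.label
  head : c'.head = c.head
  tape : ∀ i m, Sum.LiftRel (fun u z => z ∈ δ i u) (· = ·) (c'.tape i m) (c.tape i m)

namespace IsNamed

variable {c' d' : (P.onNames stm').Cfg} {c d : P.Cfg}

theorem exists_tape_eq_inl (h : IsNamed δ c' c) {i : Fin (P.L + 1)} {m : ℤ} {z : P.X i}
    (hz : c.tape i m = .inl z) : ∃ u, c'.tape i m = .inl u ∧ z ∈ δ i u := by
  obtain ⟨u, hu⟩ : ∃ u, c'.tape i m = .inl u := by
    rw [← Sum.isLeft_iff, (h.tape i m).isLeft_congr, hz, Sum.isLeft_inl]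
  refine ⟨u, hu, ?_⟩
  simpa only [hu, hz, Sum.liftRel_inl_inl] using h.tape i m

theorem scanned_eq_inr_iff (h : IsNamed δ c' c) {i : Fin (P.L + 1)} {a : P.Γ} :
    c'.scanned i = .inr a ↔ c.scanned i = .inr a := by
  have hi := h.tape i (c.head i)
  rw [Cfg.scanned, Cfg.scanned, h.head]
  generalize c'.tape i (c.head i) = s' at hi ⊢
  generalize c.tape i (c.head i) = s at hi ⊢
  cases hi with
  | inl => simp only [reduceCtorEq]
  | inr hab => rw [hab, Sum.inr.injEq, Sum.inr.injEq]

theorem exists_scanned_eq_inl (h : IsNamed δ c' c) {n : ℕ} {idx : Fin n → Fin (P.L + 1)}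
    {x : ∀ j, P.X (idx j)} (hx : ∀ j, c.scanned (idx j) = .inl (x j)) :
    ∃ x' : ∀ j, Names A (κ (idx j)), (∀ j, c'.scanned (idx j) = .inl (x' j)) ∧
      ∀ j, x j ∈ δ (idx j) (x' j) := by
  choose x' hx' hmem using fun j => h.exists_tape_eq_inl (hx j)
  exact ⟨x', fun j => by rw [Cfg.scanned, h.head]; exact hx' j, hmem⟩

theorem mem_of_scanned (h : IsNamed δ c' c) {i : Fin (P.L + 1)} {u : Names A (κ i)} {z : P.X i}
    (hu : c'.scanned i = .inl u) (hz : c.scanned i = .inl z) : z ∈ δ i u := by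
  rw [Cfg.scanned, h.head] at hu
  obtain ⟨u', hu', hmem⟩ := h.exists_tape_eq_inl hz
  rwa [Sum.inl_injective (hu.symm.trans hu')]

theorem setLabel (h : IsNamed δ c' c) (l : P.Lab) : IsNamed δ (c'.setLabel l) (c.setLabel l) :=
  ⟨rfl, h.head, h.tape⟩

theorem setHead (h : IsNamed δ c' c) (i : Fin (P.L + 1)) (m : ℤ) :
    IsNamed δ (c'.setHead i m) (c.setHead i m) :=
  ⟨h.label, by simp only [Cfg.setHead, h.head], h.tape⟩

theorem setCell (h : IsNamed δ c' c) {i : Fin (P.L + 1)} {x' x}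
    (hx : Sum.LiftRel (fun u z => z ∈ δ i u) (· = ·) x' x) :
    IsNamed δ (c'.setCell i x') (c.setCell i x) := by
  refine ⟨h.label, h.head, fun k m => ?_⟩
  simp only [Cfg.setCell, h.head]
  by_cases hk : k = i
  · subst hk
    by_cases hm : m = c.head k
    · subst hm; simpa only [Function.update_self] using hx
    · simpa only [Function.update_self, Function.update_of_ne hm] using h.tape k m
  · simpa only [Function.update_of_ne hk] using h.tape k m

theorem exists_exec (h : IsNamed δ c' c) {s s'} (hs : StmtRealizes δ s s') (hd : Exec s c d) :
    ∃ d' : (P.onNames stm').Cfg, Exec s' c' d' := by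
  cases hs with
  | right | left | write => exact ⟨_, rfl⟩
  | test i a l' l'' =>
    by_cases ha : c'.scanned i = .inr a
    · exact ⟨_, .inl ⟨ha, rfl⟩⟩
    · exact ⟨_, .inr ⟨ha, rfl⟩⟩
  | assign i n idx f g l' hr =>
    obtain ⟨x, hx, y, hy, -⟩ := hd
    obtain ⟨x', hx', hxx'⟩ := h.exists_scanned_eq_inl hx
    obtain ⟨y', hy'⟩ := (hr x' x hxx' ⟨y, hy⟩).1
    exact ⟨_, x', hx', y', hy', rfl⟩
  | branch n idx f hf g hg l' l'' hr =>
    obtain ⟨x, hx, hv⟩ := hd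
    obtain ⟨x', hx', hxx'⟩ := h.exists_scanned_eq_inl hx
    obtain ⟨v', hv'⟩ := (hr x' x hxx' (hv.elim (fun hv => ⟨_, hv.1⟩) fun hv => ⟨_, hv.1⟩)).1
    rcases hg x' v' hv' with rfl | rfl
    · exact ⟨_, x', hx', .inl ⟨hv', rfl⟩⟩
    · exact ⟨_, x', hx', .inr ⟨hv', rfl⟩⟩

theorem lift_exec_branch (h : IsNamed δ c' c) {n : ℕ} {idx : Fin n → Fin (P.L + 1)} {f hf g hg}
    {l' l'' : P.Lab} (hr : Realizes (fun j => δ (idx j)) (idWord A) (toMulti g) (toMulti f))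
    (hd' : Exec (P := P.onNames stm') (.branch n idx g hg l' l'') c' d')
    (hd : Exec (.branch n idx f hf l' l'') c d) :
    ∃ e, Exec (.branch n idx f hf l' l'') c e ∧ IsNamed δ d' e := by
  obtain ⟨x, hx, hv⟩ := hd
  obtain ⟨x', hx', hv'⟩ := hd'
  have hne : (toMulti f x).Nonempty := hv.elim (fun hv => ⟨_, hv.1⟩) fun hv => ⟨_, hv.1⟩
  have mem_f {v : List A} (hv : v ∈ g x') : v ∈ f x := by
    obtain ⟨_, hw, rfl⟩ := (hr x' x (fun j => h.mem_of_scanned (hx' j) (hx j)) hne).2 v hv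
    exact hw
  rcases hv' with ⟨hv', rfl⟩ | ⟨hv', rfl⟩
  · exact ⟨_, ⟨x, hx, .inl ⟨mem_f hv', rfl⟩⟩, h.setLabel _⟩
  · exact ⟨_, ⟨x, hx, .inr ⟨mem_f hv', rfl⟩⟩, h.setLabel _⟩

theorem lift_exec (h : IsNamed δ c' c) {s s'} (hs : StmtRealizes δ s s') (hd' : Exec s' c' d')
    (hd : Exec s c d) : ∃ e, Exec s c e ∧ IsNamed δ d' e := by
  cases hs with
  | right i l' | left i l' =>
    cases hd'
    refine ⟨_, rfl, ?_⟩
    rw [h.head]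
    exact (h.setHead _ _).setLabel _
  | write i a l' =>
    cases hd'
    exact ⟨_, rfl, (h.setCell (.inr rfl)).setLabel _⟩
  | test i a l' l'' =>
    rcases hd' with ⟨ha, rfl⟩ | ⟨ha, rfl⟩
    · exact ⟨_, .inl ⟨h.scanned_eq_inr_iff.1 ha, rfl⟩, h.setLabel _⟩
    · exact ⟨_, .inr ⟨mt h.scanned_eq_inr_iff.2 ha, rfl⟩, h.setLabel _⟩
  | assign i n idx f g l' hr =>
    obtain ⟨x, hx, y, hy, -⟩ := hd
    obtain ⟨x', hx', y', hy', rfl⟩ := hd'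
    obtain ⟨z, hz, hzy'⟩ := (hr x' x (fun j => h.mem_of_scanned (hx' j) (hx j)) ⟨y, hy⟩).2 y' hy'
    exact ⟨_, ⟨x, hx, z, hz, rfl⟩, (h.setCell (.inl hzy')).setLabel _⟩
  | branch n idx f hf g hg l' l'' hr => exact h.lift_exec_branch hr hd' hd

theorem exists_step (hs : ∀ l, StmtRealizes δ (P.stm l) (stm' l)) (h : IsNamed δ c' c)
    (hd : Step c d) : ∃ d', Step c' d' := by
  obtain ⟨label', tape', head'⟩ := c'
  obtain rfl : label' = c.label := h.label
  obtain ⟨hl, he⟩ := hd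
  obtain ⟨d', hd'⟩ := h.exists_exec (hs _) he
  exact ⟨d', hl, hd'⟩

theorem lift_step (hs : ∀ l, StmtRealizes δ (P.stm l) (stm' l)) (h : IsNamed δ c' c)
    (hc : AllAccepting c) (hd' : Step c' d') : ∃ d, Step c d ∧ IsNamed δ d' d := by
  obtain ⟨label', tape', head'⟩ := c'
  obtain rfl : label' = c.label := h.label
  obtain ⟨hl, he⟩ := hd'
  obtain ⟨_, _, hd⟩ := hc.exists_step hl
  obtain ⟨d, hd, hd'd⟩ := h.lift_exec (hs _) he hd
  exact ⟨d, ⟨hl, hd⟩, hd'd⟩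

theorem lift_reaches (hs : ∀ l, StmtRealizes δ (P.stm l) (stm' l)) (h : IsNamed δ c' c)
    (hc : AllAccepting c) (hd' : Relation.ReflTransGen Step c' d') :
    ∃ d, Relation.ReflTransGen Step c d ∧ IsNamed δ d' d := by
  induction hd' using Relation.ReflTransGen.head_induction_on generalizing c with
  | refl => exact ⟨c, .refl, h⟩
  | head hstep _ ih =>
    obtain ⟨e, he, hnamed⟩ := h.lift_step hs hc hstep
    obtain ⟨d, hd, hd'd⟩ := ih hnamed (hc.step he)
    exact ⟨d, .head he hd, hd'd⟩

theorem exists_reaches_final (hs : ∀ l, StmtRealizes δ (P.stm l) (stm' l)) (h : IsNamed δ c' c)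
    (hc : AllAccepting c) : ∃ d', Relation.ReflTransGen Step c' d' ∧ d'.label = P.lf := by
  have hacc := hc.acc
  induction hacc generalizing c' with
  | intro c _ ih =>
    by_cases hl : c.label = P.lf
    · exact ⟨c', .refl, h.label.trans hl⟩
    · obtain ⟨e, he⟩ := hc.exists_step hl
      obtain ⟨e', he'⟩ := h.exists_step hs he
      obtain ⟨d, hd, he'd⟩ := h.lift_step hs hc he'
      obtain ⟨d', hd', hl'⟩ := ih d hd he'd (hc.step hd)
      exact ⟨d', .head he' hd', hl'⟩

end IsNamed

theorem isNamed_init {x' : ∀ j, Names A (κ (P.inTape j))} {x : ∀ j, P.X (P.inTape j)}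
    (h : ∀ j, x j ∈ δ (P.inTape j) (x' j)) :
    IsNamed δ (init (P := P.onNames stm') x') (init x) := by
  refine ⟨rfl, rfl, Fin.cases (fun _ => .inr rfl) fun i m => ?_⟩
  simp only [init, Fin.cases_succ]
  by_cases hi : i.val < P.k ∧ m = 0
  · simp only [dif_pos hi]
    exact .inl (h ⟨i.val, hi.1⟩)
  · simp only [dif_neg hi]
    exact .inr rfl

theorem realizes_results (hs : ∀ l, StmtRealizes δ (P.stm l) (stm' l)) :
    Realizes (fun j => δ (P.inTape j)) (δ 0) (results (P.onNames stm')) P.fn := by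
  rintro x' x hx ⟨_, hc, -⟩
  have hinit := isNamed_init (stm' := stm') hx
  constructor
  · obtain ⟨d', hd', hl⟩ := hinit.exists_reaches_final hs hc
    obtain ⟨d, hd, hd'd⟩ := hinit.lift_reaches hs hc hd'
    obtain ⟨z, hz⟩ := hc.exists_result hd (hd'd.label.symm.trans hl)
    obtain ⟨y, hy, -⟩ := hd'd.exists_tape_eq_inl hz
    exact ⟨y, d', hd', hl, hy⟩
  · rintro y ⟨d', hd', hl, hy⟩
    obtain ⟨d, hd, hd'd⟩ := hinit.lift_reaches hs hc hd'
    have hdl := hd'd.label.symm.trans hl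
    obtain ⟨z, hz⟩ := hc.exists_result hd hdl
    obtain ⟨y', hy', hzy'⟩ := hd'd.exists_tape_eq_inl hz
    obtain rfl : y' = y := Sum.inl_injective (hy'.symm.trans hy)
    exact ⟨z, ⟨hc, d, hd, ⟨hdl, z, hz⟩, hz⟩, hzy'⟩

end GTM

end Realization

/-! ## Running a generalized Turing machine on approximations -/

theorem lookup_ofFn {α β : Type*} [DecidableEq α] {n : ℕ} {key : Fin n → α}
    (hkey : Function.Injective key) (val : Fin n → β) (j : Fin n) :
    (List.ofFn fun j => (key j, val j)).lookup (key j) = some (val j) := by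
  have hne : (List.ofFn fun j => (key j, val j)).lookup (key j) ≠ none := fun hnone => by
    simpa using List.lookup_eq_none_iff.1 hnone _ (List.mem_ofFn.2 ⟨j, rfl⟩)
  obtain ⟨v, hv⟩ := Option.ne_none_iff_exists'.1 hne
  obtain ⟨l₁, l₂, hl, -⟩ := List.lookup_eq_some_iff.1 hv
  have hmem : (key j, v) ∈ List.ofFn fun j => (key j, val j) := by simp [hl]
  obtain ⟨i, hi⟩ := List.mem_ofFn.1 hmem
  obtain ⟨hij, rfl⟩ := Prod.mk.inj hi
  rw [hv, hkey hij]

theorem lookup_ofFn_eq_none {α β : Type*} [DecidableEq α] {n : ℕ} {key : Fin n → α}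
    {val : Fin n → β} {p : α} (h : ∀ j, key j ≠ p) :
    (List.ofFn fun j => (key j, val j)).lookup p = none := by
  rw [List.lookup_eq_none_iff]
  rintro _ hq
  obtain ⟨j, rfl⟩ := List.mem_ofFn.1 hq
  simpa using (h j).symm

/-- At stage `t` the value `e t` has either been computed or is not yet known, and it is known at
all late stages. -/
structure EventuallyComputes {α : Type*} (X : ℕ → Option α) (e : ℕ → α) : Prop where
  eq_of_eq_some (t : ℕ) (x : α) : X t = some x → x = e t
  eventually_eq : ∀ᶠ t in atTop, X t = some (e t)

theorem EventuallyComputes.of_forall_eq {α : Type*} {X : ℕ → Option α} {e : ℕ → α}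
    (h : ∀ t, X t = some (e t)) : EventuallyComputes X e :=
  ⟨fun t _ hx => Option.some_injective _ (hx.symm.trans (h t)), .of_forall h⟩

theorem EventuallyComputes.bind {α β : Type*} {X : ℕ → Option α} {e : ℕ → α} {f : ℕ → α → Option β}
    {e' : ℕ → β} (h : EventuallyComputes X e) (hf : EventuallyComputes (fun t => f t (e t)) e') :
    EventuallyComputes (fun t => (X t).bind (f t)) e' where
  eq_of_eq_some t y hy := by
    obtain ⟨x, hx, hxy⟩ := Option.bind_eq_some_iff.1 hy
    obtain rfl := h.eq_of_eq_some t x hx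
    exact hf.eq_of_eq_some t y hxy
  eventually_eq := by
    filter_upwards [h.eventually_eq, hf.eventually_eq] with t ht hft
    rw [ht, Option.bind_some, hft]

/-- Statements of generalized Turing machines on tapes whose cells hold approximations of names
instead of objects. -/
inductive ApproxStmt (A : Type*) (Lab Γ : Type) (N : ℕ)
  | right (i : Fin N) (l' : Lab)
  | left (i : Fin N) (l' : Lab)
  | write (i : Fin N) (a : Γ) (l' : Lab)
  | test (i : Fin N) (a : Γ) (l' l'' : Lab)
  | assign (i : Fin N) (n : ℕ) (idx : Fin n → Fin N) (h : ApproxFn A n) (l' : Lab)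
  | branch (n : ℕ) (idx : Fin n → Fin N) (h : ApproxFn A n) (l' l'' : Lab)

/-- The function in the statement, if there is one, satisfies `C`. -/
def ApproxStmt.All {A : Type*} (C : ∀ n, ApproxFn A n → Prop) {Lab Γ : Type} {N : ℕ} :
    ApproxStmt A Lab Γ N → Prop
  | .assign _ n _ h _ => C n h
  | .branch n _ h _ _ => C n h
  | _ => True

/-- The configurations of a generalized Turing machine on approximations: a label, the head
positions, and the log of the performed write operations, the latest one first. The log represents
the tape inscriptions; as a product of encodable types, this type is subject to `Primrec`. -/
abbrev ApproxCfg (A : Type*) (Lab Γ : Type) (N : ℕ) :=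
  Lab × (Fin N → ℤ) × List ((Fin N × ℤ) × (Approx A ⊕ Γ))

namespace ApproxCfg

variable {A : Type*} {Lab Γ : Type} {N : ℕ}

/-- The current label. -/
abbrev label (c : ApproxCfg A Lab Γ N) : Lab := c.1

/-- The head positions. -/
abbrev head (c : ApproxCfg A Lab Γ N) : Fin N → ℤ := c.2.1

/-- The log of the write operations. -/
abbrev log (c : ApproxCfg A Lab Γ N) : List ((Fin N × ℤ) × (Approx A ⊕ Γ)) := c.2.2

/-- The content of cell `p.2` of tape `p.1`, where `b` is the blank. The equality test is the one
for which `Primrec.listLookup` is stated. -/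
def read (b : Γ) (c : ApproxCfg A Lab Γ N) (p : Fin N × ℤ) : Approx A ⊕ Γ :=
  (@List.lookup _ _ instBEqOfDecidableEq p c.log).getD (.inr b)

/-- The approximation in a cell; it is empty if the cell contains an element of `Γ`. -/
def readApprox (b : Γ) (c : ApproxCfg A Lab Γ N) (p : Fin N × ℤ) : Approx A :=
  (c.read b p).elim id fun _ => []

/-- The approximations under the heads of the tapes `idx j`. -/
def args (b : Γ) (c : ApproxCfg A Lab Γ N) {n : ℕ} (idx : Fin n → Fin N) : Fin n → Approx A :=
  fun j => c.readApprox b (idx j, c.head (idx j))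

/-- Write under the head of tape `i` and change the label. -/
def write (c : ApproxCfg A Lab Γ N) (i : Fin N) (v : Approx A ⊕ Γ) (l : Lab) :
    ApproxCfg A Lab Γ N :=
  (l, c.head, ((i, c.head i), v) :: c.log)

theorem read_write (b : Γ) (c : ApproxCfg A Lab Γ N) (i : Fin N) (v : Approx A ⊕ Γ) (l : Lab)
    (p : Fin N × ℤ) : (c.write i v l).read b p = if p = (i, c.head i) then v else c.read b p := by
  unfold read write
  by_cases h : p = (i, c.head i)
  · simp [log, h]
  · have hbeq : (@BEq.beq _ instBEqOfDecidableEq p (i, c.head i)) = false := by simpa using h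
    simp [log, List.lookup_cons, hbeq, h]

theorem readApprox_of_read_eq {b : Γ} {c : ApproxCfg A Lab Γ N} {p : Fin N × ℤ} {a : Approx A}
    (h : c.read b p = .inl a) : c.readApprox b p = a := by
  rw [readApprox, h, Sum.elim_inl, id]

end ApproxCfg

open Classical in
/-- The effect of a statement at stage `t`. The result is `none` if the statement is a branching
whose condition is not yet determined by the approximations. -/
noncomputable def ApproxStmt.exec {A : Type*} [Zero A] [One A] {Lab Γ : Type} {N : ℕ} (b : Γ)
    (t : ℕ) : ApproxStmt A Lab Γ N → ApproxCfg A Lab Γ N → Option (ApproxCfg A Lab Γ N)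
  | .right i l', c => some (l', Function.update c.head i (c.head i + 1), c.log)
  | .left i l', c => some (l', Function.update c.head i (c.head i - 1), c.log)
  | .write i a l', c => some (c.write i (.inr a) l')
  | .test i a l' l'', c => some (if c.read b (i, c.head i) = .inr a then l' else l'', c.2)
  | .assign i _ idx h l', c => some (c.write i (.inl (h t (c.args b idx))) l')
  | .branch _ idx h l' l'', c =>
      if (h t (c.args b idx))[0]? = some (some 0) then some (l', c.2)
      else if (h t (c.args b idx))[0]? = some (some 1) then some (l'', c.2)
      else none

/-- The statement on approximations, given second, results from the statement on names by replacing
its function, if there is one, by a function that tracks it. -/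
inductive StmtTracks {A : Type*} [Zero A] [One A] {Lab Γ : Type} {L : ℕ}
    {κ : Fin (L + 1) → NameKind} :
    Stmt A Lab Γ (fun i => Names A (κ i)) → ApproxStmt A Lab Γ (L + 1) → Prop
  | right (i l') : StmtTracks (.right i l') (.right i l')
  | left (i l') : StmtTracks (.left i l') (.left i l')
  | write (i a l') : StmtTracks (.write i a l') (.write i a l')
  | test (i a l' l'') : StmtTracks (.test i a l' l'') (.test i a l' l'')
  | assign (i n idx f h l') (hh : Tracks (κ := fun j => κ (idx j)) h f) :
      StmtTracks (.assign i n idx f l') (.assign i n idx h l')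
  | branch (n idx f hf h l' l'')
      (hh : Tracks (κ := fun j => κ (idx j)) (κ₀ := .word) h (toMulti f)) :
      StmtTracks (.branch n idx f hf l' l'') (.branch n idx h l' l'')

/-- The cell contents `u 0, u 1, …` are approximations converging to the given name, or all equal
to the given element of `Γ`. -/
def CellConvergesTo {A Γ : Type*} {κ₀ : NameKind} (u : ℕ → Approx A ⊕ Γ) : Names A κ₀ ⊕ Γ → Prop
  | .inl y => ∃ a : ℕ → Approx A, (∀ t, u t = .inl (a t)) ∧ ConvergesTo a y
  | .inr g => ∀ t, u t = .inr g

theorem CellConvergesTo.eq_inr_iff {A Γ : Type*} {κ₀ : NameKind} {u : ℕ → Approx A ⊕ Γ}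
    {v : Names A κ₀ ⊕ Γ} (h : CellConvergesTo u v) (t : ℕ) (g : Γ) : u t = .inr g ↔ v = .inr g := by
  cases v with
  | inl y =>
    obtain ⟨a, ha, -⟩ := h
    simp only [ha t, reduceCtorEq]
  | inr g' => rw [h t, Sum.inr.injEq, Sum.inr.injEq]

namespace GTM

variable {A : Type*} [Zero A] [One A] {P : GTM A} {κ : Fin (P.L + 1) → NameKind}
  {stm' : {l : P.Lab // l ≠ P.lf} → Stmt A P.Lab P.Γ fun i => Names A (κ i)}

/-- The configurations `E 0, E 1, …` on approximations converge to the configuration `c` on names;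
they differ only in the precision of the approximations. -/
structure CfgConvergesTo (E : ℕ → ApproxCfg A P.Lab P.Γ (P.L + 1)) (c : (P.onNames stm').Cfg) :
    Prop where
  label : ∀ t, (E t).label = c.label
  head : ∀ t, (E t).head = c.head
  tape : ∀ i m, CellConvergesTo (fun t => (E t).read P.b (i, m)) (c.tape i m)

namespace CfgConvergesTo

variable {E : ℕ → ApproxCfg A P.Lab P.Γ (P.L + 1)} {c d : (P.onNames stm').Cfg}

theorem setLabel (h : CfgConvergesTo E c) (l : P.Lab) :
    CfgConvergesTo (fun t => (l, (E t).2)) (c.setLabel l) :=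
  ⟨fun _ => rfl, h.head, h.tape⟩

theorem setHead (h : CfgConvergesTo E c) (i : Fin (P.L + 1)) (g : ℤ → ℤ) (l : P.Lab) :
    CfgConvergesTo (fun t => (l, Function.update (E t).head i (g ((E t).head i)), (E t).log))
      ((c.setHead i (g (c.head i))).setLabel l) :=
  ⟨fun _ => rfl, fun t => by simp only [Cfg.setHead, Cfg.setLabel, h.head], h.tape⟩

theorem write (h : CfgConvergesTo E c) {i : Fin (P.L + 1)} {u : ℕ → Approx A ⊕ P.Γ}
    {v : Names A (κ i) ⊕ P.Γ} (hu : CellConvergesTo u v) (l : P.Lab) :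
    CfgConvergesTo (fun t => (E t).write i (u t) l) ((c.setCell i v).setLabel l) := by
  refine ⟨fun _ => rfl, h.head, fun k m => ?_⟩
  simp only [ApproxCfg.read_write, Cfg.setCell, Cfg.setLabel, h.head, Prod.mk.injEq]
  by_cases hk : k = i
  · subst hk
    simp only [Function.update_self, true_and]
    by_cases hm : m = c.head k
    · subst hm; simpa only [Function.update_self, if_true] using hu
    · simpa only [Function.update_of_ne hm, if_neg hm] using h.tape k m
  · simpa only [Function.update_of_ne hk, hk, false_and, if_false] using h.tape k m

theorem readApprox (h : CfgConvergesTo E c) {i : Fin (P.L + 1)} {m : ℤ} {y : Names A (κ i)}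
    (hy : c.tape i m = .inl y) : ConvergesTo (fun t => (E t).readApprox P.b (i, m)) y := by
  have hcell := h.tape i m
  rw [hy] at hcell
  obtain ⟨a, ha, hay⟩ := hcell
  exact (funext fun t => ApproxCfg.readApprox_of_read_eq (ha t) :
    (fun t => (E t).readApprox P.b (i, m)) = a) ▸ hay

theorem args (h : CfgConvergesTo E c) {n : ℕ} {idx : Fin n → Fin (P.L + 1)}
    {x : ∀ j, Names A (κ (idx j))} (hx : ∀ j, c.scanned (idx j) = .inl (x j)) (j : Fin n) :
    ConvergesTo (fun t => (E t).args P.b idx j) (x j) := by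
  simpa only [ApproxCfg.args, h.head] using h.readApprox (hx j)

theorem exec_test (h : CfgConvergesTo E c) (i : Fin (P.L + 1)) (a : P.Γ) (l' l'' : P.Lab)
    (hd : Exec (P := P.onNames stm') (.test i a l' l'') c d) :
    ∃ E', CfgConvergesTo E' d ∧
      ∀ t, (ApproxStmt.test i a l' l'').exec P.b t (E t) = some (E' t) := by
  have read_eq_iff (t : ℕ) : (E t).read P.b (i, (E t).head i) = .inr a ↔ c.scanned i = .inr a := by
    rw [h.head]
    exact (h.tape i (c.head i)).eq_inr_iff t a
  rcases hd with ⟨ha, rfl⟩ | ⟨ha, rfl⟩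
  · exact ⟨_, h.setLabel l', fun t => by simp only [ApproxStmt.exec, if_pos ((read_eq_iff t).2 ha)]⟩
  · exact ⟨_, h.setLabel l'', fun t => by
      simp only [ApproxStmt.exec, if_neg (mt (read_eq_iff t).1 ha)]⟩

theorem exec_branch (h01 : (0 : A) ≠ 1) (h : CfgConvergesTo E c) {n : ℕ}
    {idx : Fin n → Fin (P.L + 1)} {f : (∀ j, Names A (κ (idx j))) →. Names A .word} {hf}
    {g : ApproxFn A n} {l' l'' : P.Lab}
    (hg : Tracks (κ := fun j => κ (idx j)) (κ₀ := .word) g (toMulti f))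
    (hd : Exec (P := P.onNames stm') (.branch n idx f hf l' l'') c d) :
    ∃ E', CfgConvergesTo E' d ∧
      EventuallyComputes (fun t => (ApproxStmt.branch n idx g l' l'').exec P.b t (E t)) E' := by
  obtain ⟨x, hx, hv⟩ := hd
  have converges (v : List A) (hv : v ∈ f x) :
      ConvergesTo (fun t => g t ((E t).args P.b idx)) (κ₀ := .word) v :=
    hg x v hv (fun t => (E t).args P.b idx) (h.args hx)
  simp only [ApproxStmt.exec]
  rcases hv with ⟨hv, rfl⟩ | ⟨hv, rfl⟩
  · refine ⟨_, h.setLabel l', fun t e he => ?_, ?_⟩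
    · split_ifs at he with _ h1
      · exact (Option.some_injective _ he).symm
      · have := (converges _ hv).approximates t 0 _ h1
        exact absurd (Option.some_injective _ this) h01
    · filter_upwards [(converges _ hv).eventually_getElem? 0] with t ht
      exact if_pos ht
  · refine ⟨_, h.setLabel l'', fun t e he => ?_, ?_⟩
    · split_ifs at he with h0
      · have := (converges _ hv).approximates t 0 _ h0
        exact absurd (Option.some_injective _ this) h01.symm
      · exact (Option.some_injective _ he).symm
    · filter_upwards [(converges _ hv).eventually_getElem? 0] with t ht
      have hne : ¬(g t ((E t).args P.b idx))[0]? = some (some 0) := fun h0 =>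
        h01 (Option.some_injective _ (Option.some_injective _ (h0.symm.trans ht)))
      rw [if_neg hne]
      exact if_pos ht

theorem exec (h01 : (0 : A) ≠ 1) (h : CfgConvergesTo E c)
    {s : Stmt A P.Lab P.Γ fun i => Names A (κ i)} {s' : ApproxStmt A P.Lab P.Γ (P.L + 1)}
    (hs : StmtTracks s s') (hd : Exec (P := P.onNames stm') s c d) :
    ∃ E', CfgConvergesTo E' d ∧ EventuallyComputes (fun t => s'.exec P.b t (E t)) E' := by
  cases hs with
  | right i l' =>
    cases hd
    exact ⟨_, h.setHead i (· + 1) l', .of_forall_eq fun _ => rfl⟩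
  | left i l' =>
    cases hd
    exact ⟨_, h.setHead i (· - 1) l', .of_forall_eq fun _ => rfl⟩
  | write i a l' =>
    cases hd
    exact ⟨_, h.write (u := fun _ => .inr a) (v := .inr a) (fun _ => rfl) l',
      .of_forall_eq fun _ => rfl⟩
  | test i a l' l'' =>
    obtain ⟨E', hE', hexec⟩ := h.exec_test i a l' l'' hd
    exact ⟨E', hE', .of_forall_eq hexec⟩
  | assign i n idx f g l' hg =>
    obtain ⟨x, hx, y, hy, rfl⟩ := hd
    have hgy := hg x y hy (fun t => (E t).args P.b idx) (h.args hx)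
    exact ⟨_, h.write (u := fun t => .inl (g t ((E t).args P.b idx))) (v := .inl y)
      ⟨_, fun _ => rfl, hgy⟩ l', .of_forall_eq fun _ => rfl⟩
  | branch n idx f hf g l' l'' hg => exact h.exec_branch h01 hg hd

end CfgConvergesTo

variable (P) in
/-- The initial configuration for given approximations of the inputs. -/
def approxInit (a : Fin P.k → Approx A) : ApproxCfg A P.Lab P.Γ (P.L + 1) :=
  (P.l₀, fun _ => 0, List.ofFn fun j => ((P.inTape j, 0), .inl (a j)))

theorem inTape_injective : Function.Injective P.inTape := fun i j h => by
  simpa [inTape, Fin.ext_iff] using h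

theorem approxInit_read_inTape (a : Fin P.k → Approx A) (j : Fin P.k) :
    (P.approxInit a).read P.b (P.inTape j, 0) = .inl (a j) := by
  unfold ApproxCfg.read approxInit
  rw [lookup_ofFn (key := fun j => (P.inTape j, (0 : ℤ)))
    fun _ _ h => inTape_injective (Prod.mk.inj h).1]
  rfl

theorem approxInit_read_of_forall_ne (a : Fin P.k → Approx A) {i : Fin (P.L + 1)} {m : ℤ}
    (h : ∀ j, ¬(P.inTape j = i ∧ m = 0)) : (P.approxInit a).read P.b (i, m) = .inr P.b := by
  unfold ApproxCfg.read approxInit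
  rw [lookup_ofFn_eq_none (key := fun j => (P.inTape j, (0 : ℤ)))
    fun j hj => h j ⟨(Prod.mk.inj hj).1, (Prod.mk.inj hj).2.symm⟩]
  rfl

theorem cfgConvergesTo_init {a : ℕ → Fin P.k → Approx A} {x : ∀ j, Names A (κ (P.inTape j))}
    (h : ∀ j, ConvergesTo (fun t => a t j) (x j)) :
    CfgConvergesTo (fun t => P.approxInit (a t)) (init (P := P.onNames stm') x) := by
  refine ⟨fun _ => rfl, fun _ => rfl, Fin.cases (fun _ t => ?_) fun i m => ?_⟩
  · exact approxInit_read_of_forall_ne _ fun j hj => Fin.succ_ne_zero _ hj.1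
  · simp only [init, Fin.cases_succ]
    by_cases hi : i.val < P.k ∧ m = 0
    · obtain ⟨hi, rfl⟩ := hi
      rw [dif_pos ⟨hi, rfl⟩]
      exact ⟨fun t => a t ⟨i, hi⟩, fun t => approxInit_read_inTape (a t) ⟨i, hi⟩, h ⟨i, hi⟩⟩
    · rw [dif_neg hi]
      refine fun t => approxInit_read_of_forall_ne _ fun j hj => hi ⟨?_, hj.2⟩
      have hval := congrArg Fin.val hj.1
      simp only [inTape, Fin.val_succ, Fin.val_castLE] at hval
      omega

variable (P) (hs : {l : P.Lab // l ≠ P.lf} → ApproxStmt A P.Lab P.Γ (P.L + 1))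

open Classical in
/-- One step at stage `t`, with no effect on final configurations. -/
noncomputable def approxStep (t : ℕ) (c : ApproxCfg A P.Lab P.Γ (P.L + 1)) :
    Option (ApproxCfg A P.Lab P.Γ (P.L + 1)) :=
  if h : c.label ≠ P.lf then (hs ⟨c.label, h⟩).exec P.b t c else some c

/-- The configuration after `s` steps at stage `t`, if all branchings on the way are determined. -/
noncomputable def approxRun (t s : ℕ) (a : Fin P.k → Approx A) :
    Option (ApproxCfg A P.Lab P.Γ (P.L + 1)) :=
  (Option.bind · (P.approxStep hs t))^[s] (some (P.approxInit a))

open Classical in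
/-- The result after `t` steps at stage `t`; it is empty as long as no final configuration is
reached. -/
noncomputable def approxResult : ApproxFn A P.k := fun t a =>
  (P.approxRun hs t t a).elim [] fun c => if c.label = P.lf then c.readApprox P.b (0, 0) else []

variable {P hs}

theorem approxRun_succ (t s : ℕ) (a : Fin P.k → Approx A) :
    P.approxRun hs t (s + 1) a = (P.approxRun hs t s a).bind (P.approxStep hs t) :=
  Function.iterate_succ_apply' _ _ _

theorem approxStep_of_ne {t : ℕ} {c : ApproxCfg A P.Lab P.Γ (P.L + 1)} {l : P.Lab}
    (hl : l ≠ P.lf) (hc : c.label = l) : P.approxStep hs t c = (hs ⟨l, hl⟩).exec P.b t c := by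
  subst hc
  rw [approxStep, dif_pos hl]

theorem approxRun_of_le {t s s' : ℕ} {a : Fin P.k → Approx A}
    {c : ApproxCfg A P.Lab P.Γ (P.L + 1)} (h : P.approxRun hs t s a = some c)
    (hc : c.label = P.lf) (hss' : s ≤ s') : P.approxRun hs t s' a = some c := by
  induction s', hss' using Nat.le_induction with
  | base => exact h
  | succ s' _ ih => rw [approxRun_succ, ih, Option.bind_some, approxStep, dif_neg (not_not.2 hc)]

theorem exists_approxRun_of_le {t s s' : ℕ} {a : Fin P.k → Approx A}
    {c : ApproxCfg A P.Lab P.Γ (P.L + 1)} (h : P.approxRun hs t s' a = some c) (hss' : s ≤ s') :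
    ∃ e, P.approxRun hs t s a = some e := by
  induction s', hss' using Nat.le_induction generalizing c with
  | base => exact ⟨c, h⟩
  | succ s' _ ih =>
    rw [approxRun_succ] at h
    obtain ⟨e, he, -⟩ := Option.bind_eq_some_iff.1 h
    exact ih he

theorem exists_eventuallyComputes_approxRun (h01 : (0 : A) ≠ 1)
    (hst : ∀ l, StmtTracks (stm' l) (hs l)) {a : ℕ → Fin P.k → Approx A}
    {x : ∀ j, Names A (κ (P.inTape j))} (h : ∀ j, ConvergesTo (fun t => a t j) (x j))
    {d : (P.onNames stm').Cfg} (hd : Relation.ReflTransGen Step (init x) d) :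
    ∃ N E, CfgConvergesTo E d ∧ EventuallyComputes (fun t => P.approxRun hs t N (a t)) E := by
  induction hd with
  | refl => exact ⟨0, _, cfgConvergesTo_init h, .of_forall_eq fun _ => rfl⟩
  | tail _ hstep ih =>
    obtain ⟨N, E, hE, hrun⟩ := ih
    obtain ⟨hl, hexec⟩ := hstep
    obtain ⟨E', hE', hexec'⟩ := hE.exec h01 (hst _) hexec
    have step_eq (t : ℕ) : P.approxStep hs t (E t) = (hs ⟨_, hl⟩).exec P.b t (E t) :=
      approxStep_of_ne hl (hE.label t)
    refine ⟨N + 1, E', hE', ?_⟩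
    simp only [approxRun_succ]
    exact hrun.bind (by simpa only [step_eq] using hexec')

theorem eventuallyComputes_approxRun_self {N : ℕ} {a : ℕ → Fin P.k → Approx A}
    {E : ℕ → ApproxCfg A P.Lab P.Γ (P.L + 1)} (hE : ∀ t, (E t).label = P.lf)
    (h : EventuallyComputes (fun t => P.approxRun hs t N (a t)) E) {t : ℕ}
    {c : ApproxCfg A P.Lab P.Γ (P.L + 1)} (hrun : P.approxRun hs t t (a t) = some c)
    (hc : c.label = P.lf) : c = E t := by
  rcases le_total t N with htN | hNt
  · exact h.eq_of_eq_some t c (approxRun_of_le hrun hc htN)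
  · obtain ⟨e, he⟩ := exists_approxRun_of_le hrun hNt
    obtain rfl := h.eq_of_eq_some t e he
    exact Option.some_injective _ (hrun.symm.trans (approxRun_of_le he (hE t) hNt))

theorem tracks_approxResult (h01 : (0 : A) ≠ 1) (hst : ∀ l, StmtTracks (stm' l) (hs l)) :
    Tracks (κ := fun j => κ (P.inTape j)) (κ₀ := κ 0) (P.approxResult hs)
      (results (P.onNames stm')) := by
  rintro x y ⟨d, hd, hl, hy⟩ a ha
  obtain ⟨N, E, hE, hrun⟩ := exists_eventuallyComputes_approxRun h01 hst ha hd
  have hlf (t : ℕ) : (E t).label = P.lf := (hE.label t).trans hl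
  have hconv := hE.readApprox hy
  refine hconv.congr' (fun t => ?_) ?_
  · unfold approxResult
    cases hc : P.approxRun hs t t (a t) with
    | none => exact fun m v hv => absurd hv (by simp)
    | some c =>
      rw [Option.elim_some]
      split_ifs with hcl
      · rw [eventuallyComputes_approxRun_self hlf hrun hc hcl]
        exact hconv.approximates t
      · exact fun m v hv => absurd hv (by simp)
  · filter_upwards [hrun.eventually_eq, eventually_ge_atTop N] with t ht hNt
    simp only [approxResult, approxRun_of_le ht (hlf t) hNt, Option.elim_some, if_pos (hlf t)]

end GTM

/-! ## Primitive recursiveness of the execution on approximations -/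

/-- An encoding of a finite type. -/
@[reducible]
noncomputable def primcodableOfFinite (α : Type*) [Finite α] : Primcodable α :=
  Primcodable.ofEquiv (Fin (Nat.card α)) (Finite.equivFin α)

section Primrec

variable {α β σ : Type*} [Primcodable α] [Primcodable β] [Primcodable σ]

theorem primrec_pi {n : ℕ} {f : α → Fin n → σ} (h : ∀ i, Primrec fun a => f a i) : Primrec f :=
  Primrec.fin_curry.2 (Primrec₂.swap (Primrec.fin_curry₁.2 h))

theorem primrec_apply {n : ℕ} {f : α → Fin n → σ} (h : Primrec f) (i : Fin n) :
    Primrec fun a => f a i :=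
  Primrec.fin_app.comp h (Primrec.const i)

theorem primrec_update {n : ℕ} {f : α → Fin n → σ} {g : α → σ} (hf : Primrec f) (hg : Primrec g)
    (i : Fin n) : Primrec fun a => Function.update (f a) i (g a) := by
  refine primrec_pi fun j => ?_
  by_cases h : j = i
  · subst h
    simpa only [Function.update_self] using hg
  · simpa only [Function.update_of_ne h] using primrec_apply hf j

theorem primrec₂_of_finite [Finite α] {f : α → β → σ} (h : ∀ a, Primrec (f a)) : Primrec₂ f := by
  have primrec₂_fin : Primrec₂ fun (i : Fin (Nat.card α)) b => f ((Finite.equivFin α).symm i) b :=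
    Primrec.fin_curry₁.2 fun i => h _
  have primrec_equivFin : Primrec (Finite.equivFin α) := Primrec.dom_finite _
  refine (primrec₂_fin.comp₂ (primrec_equivFin.comp₂ Primrec₂.left) Primrec₂.right).of_eq ?_
  simp

theorem encode_int_natCast (n : ℕ) : Encodable.encode (n : ℤ) = 2 * n := rfl

theorem encode_int_negSucc (n : ℕ) : Encodable.encode (Int.negSucc n) = 2 * n + 1 := rfl

theorem primrec_int_add_one : Primrec fun z : ℤ => z + 1 := by
  have onCodes : Primrec fun n : ℕ => if n % 2 = 0 then n + 2 else if n = 1 then 0 else n - 2 :=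
    Primrec.ite (Primrec.eq.comp (Primrec.nat_mod.comp Primrec.id (Primrec.const 2))
      (Primrec.const 0)) (Primrec.nat_add.comp Primrec.id (Primrec.const 2))
      (Primrec.ite (Primrec.eq.comp Primrec.id (Primrec.const 1)) (Primrec.const 0)
        (Primrec.nat_sub.comp Primrec.id (Primrec.const 2)))
  refine Primrec.encode_iff.1 ((onCodes.comp Primrec.encode).of_eq fun z => ?_)
  rcases z with n | n | n
  · have hsucc := encode_int_natCast (n + 1)
    push_cast at hsucc
    rw [Int.ofNat_eq_natCast, hsucc, encode_int_natCast, if_pos (by omega)]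
    ring
  · rfl
  · have hadd : Int.negSucc (n + 1) + 1 = Int.negSucc n := by omega
    rw [hadd, encode_int_negSucc, encode_int_negSucc, if_neg (by omega), if_neg (by omega)]
    omega

theorem primrec_int_sub_one : Primrec fun z : ℤ => z - 1 := by
  have onCodes : Primrec fun n : ℕ => if n % 2 = 1 then n + 2 else if n = 0 then 1 else n - 2 :=
    Primrec.ite (Primrec.eq.comp (Primrec.nat_mod.comp Primrec.id (Primrec.const 2))
      (Primrec.const 1)) (Primrec.nat_add.comp Primrec.id (Primrec.const 2))
      (Primrec.ite (Primrec.eq.comp Primrec.id (Primrec.const 0)) (Primrec.const 1)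
        (Primrec.nat_sub.comp Primrec.id (Primrec.const 2)))
  refine Primrec.encode_iff.1 ((onCodes.comp Primrec.encode).of_eq fun z => ?_)
  rcases z with (_ | n) | n
  · rfl
  · have hsub : Int.ofNat (n + 1) - 1 = (n : ℤ) := by simp
    rw [hsub, Int.ofNat_eq_natCast, encode_int_natCast, encode_int_natCast, if_neg (by omega),
      if_neg (by omega)]
    omega
  · have hsub : Int.negSucc n - 1 = Int.negSucc (n + 1) := by omega
    rw [hsub, encode_int_negSucc, encode_int_negSucc, if_pos (by omega)]
    ring

end Primrec

section PrimrecExec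

variable {A : Type*} [Primcodable A] {Lab Γ : Type} [Primcodable Lab] [Primcodable Γ] {N : ℕ}
  {α : Type*} [Primcodable α] {c : α → ApproxCfg A Lab Γ N}

theorem primrec_head (hc : Primrec c) (i : Fin N) : Primrec fun x => (c x).head i :=
  primrec_apply (Primrec.fst.comp (Primrec.snd.comp hc)) i

theorem primrec_log (hc : Primrec c) : Primrec fun x => (c x).log :=
  Primrec.snd.comp (Primrec.snd.comp hc)

theorem primrec_read (b : Γ) {p : α → Fin N × ℤ} (hc : Primrec c) (hp : Primrec p) :
    Primrec fun x => (c x).read b (p x) :=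
  Primrec.option_getD.comp (Primrec.listLookup.comp hp (primrec_log hc)) (Primrec.const _)

theorem primrec_readApprox (b : Γ) {p : α → Fin N × ℤ} (hc : Primrec c) (hp : Primrec p) :
    Primrec fun x => (c x).readApprox b (p x) :=
  (Primrec.sumCasesOn (primrec_read b hc hp) Primrec₂.right (Primrec₂.const [])).of_eq fun x => by
    unfold ApproxCfg.readApprox
    cases (c x).read b (p x) <;> rfl

theorem primrec_args (b : Γ) (hc : Primrec c) {n : ℕ} (idx : Fin n → Fin N) :
    Primrec fun x => (c x).args b idx :=
  primrec_pi fun j => primrec_readApprox b hc ((Primrec.const (idx j)).pair (primrec_head hc _))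

theorem primrec_write {v : α → Approx A ⊕ Γ} (hc : Primrec c) (hv : Primrec v) (i : Fin N)
    (l : Lab) : Primrec fun x => (c x).write i (v x) l :=
  (Primrec.const l).pair ((Primrec.fst.comp (Primrec.snd.comp hc)).pair
    (Primrec.list_cons.comp (((Primrec.const i).pair (primrec_head hc i)).pair hv)
      (primrec_log hc)))

theorem primrec_moveHead (hc : Primrec c) {g : ℤ → ℤ} (hg : Primrec g) (i : Fin N) (l : Lab) :
    Primrec fun x => (l, Function.update (c x).head i (g ((c x).head i)), (c x).log) :=
  (Primrec.const l).pair ((primrec_update (Primrec.fst.comp (Primrec.snd.comp hc))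
    (hg.comp (primrec_head hc i)) i).pair (primrec_log hc))

open Classical in
theorem primrec_exec [Zero A] [One A] (b : Γ) {s : ApproxStmt A Lab Γ N}
    (hs : s.All fun _ h => Primrec₂ h) :
    Primrec₂ fun t (c : ApproxCfg A Lab Γ N) => s.exec b t c := by
  have hc : Primrec fun p : ℕ × ApproxCfg A Lab Γ N => p.2 := Primrec.snd
  have setLabel (l : Lab) : Primrec fun p : ℕ × ApproxCfg A Lab Γ N => (l, p.2.2) :=
    (Primrec.const l).pair (Primrec.snd.comp hc)
  cases s with
  | right i l' => exact Primrec.option_some.comp (primrec_moveHead hc primrec_int_add_one i l')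
  | left i l' => exact Primrec.option_some.comp (primrec_moveHead hc primrec_int_sub_one i l')
  | write i a l' => exact Primrec.option_some.comp (primrec_write hc (Primrec.const _) i l')
  | test i a l' l'' =>
    have scanned_eq := PrimrecRel.comp Primrec.eq
      (primrec_read b hc ((Primrec.const i).pair (primrec_head hc i))) (Primrec.const (.inr a))
    exact Primrec.option_some.comp ((Primrec.ite scanned_eq (Primrec.const l')
      (Primrec.const l'')).pair (Primrec.snd.comp hc))
  | assign i n idx h l' =>
    have value := hs.comp Primrec.fst (primrec_args b hc idx)
    exact Primrec.option_some.comp (primrec_write hc (Primrec.sumInl.comp value) i l')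
  | branch n idx h l' l'' =>
    have value := hs.comp Primrec.fst (primrec_args b hc idx)
    have firstSymbol := Primrec.list_getElem?.comp value (Primrec.const 0)
    exact Primrec.ite (Primrec.eq.comp firstSymbol (Primrec.const _))
      (Primrec.option_some.comp (setLabel l'))
      (Primrec.ite (Primrec.eq.comp firstSymbol (Primrec.const _))
        (Primrec.option_some.comp (setLabel l'')) (Primrec.const none))

namespace GTM

variable [Zero A] [One A] {P : GTM A} [Primcodable P.Lab] [Primcodable P.Γ]
  {hs : {l : P.Lab // l ≠ P.lf} → ApproxStmt A P.Lab P.Γ (P.L + 1)}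

theorem primrec_approxStep (h : ∀ l, (hs l).All fun _ h => Primrec₂ h) :
    Primrec₂ (P.approxStep hs) := by
  classical
  have := P.finLab
  have step_of_label : Primrec₂ fun (l : P.Lab) (p : ℕ × ApproxCfg A P.Lab P.Γ (P.L + 1)) =>
      if h : l ≠ P.lf then (hs ⟨l, h⟩).exec P.b p.1 p.2 else some p.2 := by
    refine primrec₂_of_finite fun l => ?_
    by_cases hl : l ≠ P.lf
    · simp only [dif_pos hl]
      exact primrec_exec P.b (h ⟨l, hl⟩)
    · simp only [dif_neg hl]
      exact Primrec.option_some.comp Primrec.snd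
  exact (step_of_label.comp (Primrec.fst.comp Primrec.snd) Primrec.id).of_eq fun p => by
    rw [approxStep]; rfl

theorem primrec_approxInit : Primrec P.approxInit :=
  (Primrec.const _).pair ((Primrec.const _).pair (Primrec.list_ofFn fun j =>
    (Primrec.const _).pair (Primrec.sumInl.comp (primrec_apply Primrec.id j))))

open Classical in
theorem primrec_approxResult (h : ∀ l, (hs l).All fun _ h => Primrec₂ h) :
    Primrec₂ (P.approxResult hs) := by
  have run : Primrec fun p : ℕ × (Fin P.k → Approx A) => P.approxRun hs p.1 p.1 p.2 :=
    Primrec.nat_iterate Primrec.fst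
      (Primrec.option_some.comp (primrec_approxInit.comp Primrec.snd))
      (Primrec.option_bind Primrec.snd ((primrec_approxStep h).comp₂
        ((Primrec.fst.comp Primrec.fst).comp₂ Primrec₂.left) Primrec₂.right))
  have result : Primrec fun c : ApproxCfg A P.Lab P.Γ (P.L + 1) =>
      if c.label = P.lf then c.readApprox P.b (0, 0) else [] :=
    Primrec.ite (Primrec.eq.comp Primrec.fst (Primrec.const _))
      (primrec_readApprox P.b Primrec.id (Primrec.const _)) (Primrec.const [])
  exact (Primrec.option_casesOn run (Primrec.const []) (result.comp₂ Primrec₂.right)).of_eq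
    fun p => by
      unfold approxResult
      cases P.approxRun hs p.1 p.1 p.2 <;> rfl

end GTM

end PrimrecExec

/-! ## Running a Type-2 machine on approximations -/

/-- A tape, given by lists of symbols to the left and to the right of the scanned symbol. In
contrast to `Turing.Tape`, this type is subject to `Primrec`. -/
abbrev ListTape (S : Type) := List S × S × List S

namespace ListTape

variable {S : Type} [Inhabited S]

/-- The tape described by a list tape. -/
def toTape (T : ListTape S) : Turing.Tape S :=
  ⟨T.2.1, Turing.ListBlank.mk T.1, Turing.ListBlank.mk T.2.2⟩

/-- Write a symbol and move the head. -/
def writeMove (d : Option Turing.Dir) (s : S) (T : ListTape S) : ListTape S :=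
  match d with
  | none => (T.1, s, T.2.2)
  | some .left => (T.1.tail, T.1.headI, s :: T.2.2)
  | some .right => (s :: T.1, T.2.2.headI, T.2.2.tail)

theorem toTape_writeMove (d : Option Turing.Dir) (s : S) (T : ListTape S) :
    (T.writeMove d s).toTape = Type2Machine.moveWork d (T.toTape.write s) := by
  rcases d with _ | _ | _ <;> rfl

theorem primrec_writeMove [Primcodable S] (d : Option Turing.Dir) (s : S) :
    Primrec (writeMove d s) := by
  have leftList : Primrec fun T : ListTape S => T.1 := Primrec.fst
  have rightList : Primrec fun T : ListTape S => T.2.2 := Primrec.snd.comp Primrec.snd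
  rcases d with _ | _ | _
  · exact leftList.pair ((Primrec.const s).pair rightList)
  · exact (Primrec.list_tail.comp leftList).pair ((Primrec.list_headI.comp leftList).pair
      (Primrec.list_cons.comp (Primrec.const s) rightList))
  · exact (Primrec.list_cons.comp (Primrec.const s) leftList).pair
      ((Primrec.list_headI.comp rightList).pair (Primrec.list_tail.comp rightList))

end ListTape

namespace Type2Machine

variable {A : Type*} {n : ℕ} (M : Type2Machine A n)

/-- Configurations with list tapes as work tapes. -/
abbrev ListCfg := M.Q × (Fin n → ℕ) × (Fin M.w → ListTape M.S) × List A

/-- What determines the next action of a machine that runs on approximations: the state, the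
contents of the scanned cells of the input tapes, as far as they are known, and the scanned symbols
of the work tapes. -/
abbrev View := M.Q × (Fin n → Option (Option A)) × (Fin M.w → M.S)

variable {M}

namespace View

/-- The contents of all scanned cells of the input tapes are known. -/
def Known (v : M.View) : Prop := ∀ j, (v.2.1 j).isSome

/-- The next action, if the machine does not halt, provided that `v.Known`. -/
def action (v : M.View) : Option (Type2Action A n M.w M.Q M.S) :=
  M.prog v.1 (fun j => (v.2.1 j).join) v.2.2

end View

namespace ListCfg

/-- The current state. -/
abbrev state (c : M.ListCfg) : M.Q := c.1

/-- The head positions on the input tapes. -/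
abbrev pos (c : M.ListCfg) : Fin n → ℕ := c.2.1

/-- The work tapes. -/
abbrev work (c : M.ListCfg) : Fin M.w → ListTape M.S := c.2.2.1

/-- The word on the output tape. -/
abbrev output (c : M.ListCfg) : List A := c.2.2.2

/-- The configuration described by lists. -/
def toCfg (c : M.ListCfg) : M.Cfg :=
  ⟨c.state, c.pos, fun j => (c.work j).toTape, c.output⟩

/-- What the machine sees if the input tapes contain the given approximations. -/
def view (a : Fin n → Approx A) (c : M.ListCfg) : M.View :=
  (c.state, fun j => (a j)[c.pos j]?, fun j => (c.work j).2.1)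

/-- Perform an action. -/
def act (α : Type2Action A n M.w M.Q M.S) (c : M.ListCfg) : M.ListCfg :=
  (α.next, fun j => moveInput (α.inputMove j) (c.pos j),
    fun j => (c.work j).writeMove (α.workMove j) (α.write j), c.output ++ α.out.toList)

open Classical in
/-- One step on approximations of the inputs; nothing changes if the contents of the scanned cells
are not known or the machine halts. -/
noncomputable def next (a : Fin n → Approx A) (c : M.ListCfg) : M.ListCfg :=
  if (c.view a).Known then (c.view a).action.elim c c.act else c

end ListCfg

variable (M) in
/-- The configuration after `s` steps on approximations of the inputs. -/
noncomputable def listRun (a : Fin n → Approx A) (s : ℕ) : M.ListCfg :=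
  (ListCfg.next a)^[s] (M.start, fun _ => 0, fun _ => ([], default, []), [])

variable (M) in
open Classical in
/-- The approximation of the result after `t` steps. Once the machine is known to have halted, the
cells to the right of the output are known to be blank. -/
noncomputable def approxOutput : ApproxFn A n := fun t a =>
  (M.listRun a t).output.map some ++
    if ((M.listRun a t).view a).Known ∧ ((M.listRun a t).view a).action = none then
      List.replicate t none
    else []

section Correctness

variable {κ : Fin n → NameKind} {κ₀ : NameKind} {x : ∀ j, Names A (κ j)} {a : Fin n → Approx A}
  {c : M.ListCfg} {y : Names A κ₀}

theorem ListCfg.step_toCfg (ha : ∀ j, Approximates (a j) (x j)) (h : (c.view a).Known) :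
    M.step x c.toCfg = (c.view a).action.map fun α => (c.act α).toCfg := by
  have symbols_eq : (fun j => ((c.view a).2.1 j).join) = fun j => (x j).cell (c.pos j) := by
    funext j
    obtain ⟨v, hv⟩ := Option.isSome_iff_exists.1 (h j)
    rw [hv, ha j _ v hv]
    rfl
  rw [View.action, symbols_eq]
  refine congrArg (Option.map · _) (funext fun α => ?_)
  simp only [toCfg, act, state, pos, work, output, ListTape.toTape_writeMove]

theorem ListCfg.reaches_next (ha : ∀ j, Approximates (a j) (x j)) :
    Reaches (M.step x) c.toCfg (c.next a).toCfg := by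
  unfold next
  split_ifs with h
  · have hstep := step_toCfg ha h
    cases hact : (c.view a).action with
    | none => exact .refl
    | some α => exact .single (by rw [hstep, hact]; rfl)
  · exact .refl

theorem listRun_succ (a : Fin n → Approx A) (s : ℕ) :
    M.listRun a (s + 1) = (M.listRun a s).next a :=
  Function.iterate_succ_apply' _ _ _

theorem reaches_listRun_of_le (ha : ∀ j, Approximates (a j) (x j)) {s t : ℕ} (hst : s ≤ t) :
    Reaches (M.step x) (M.listRun a s).toCfg (M.listRun a t).toCfg := by
  induction t, hst using Nat.le_induction with
  | base => exact .refl
  | succ t _ ih =>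
    rw [listRun_succ]
    exact ih.trans (ListCfg.reaches_next ha)

theorem reaches_listRun (ha : ∀ j, Approximates (a j) (x j)) (t : ℕ) :
    Reaches (M.step x) M.init (M.listRun a t).toCfg :=
  reaches_listRun_of_le ha t.zero_le

theorem output_prefix_of_reaches {c d : M.Cfg} (h : Reaches (M.step x) c d) :
    c.output <+: d.output := by
  induction h with
  | refl => exact List.prefix_rfl
  | tail _ h ih =>
    obtain ⟨α, -, rfl⟩ := Option.map_eq_some_iff.1 h
    exact ih.trans (List.prefix_append _ _)

theorem getElem?_output_of_reaches {c d : M.Cfg} (h : Reaches (M.step x) c d) {m : ℕ} {v : A}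
    (hv : c.output[m]? = some v) : d.output[m]? = some v := by
  obtain ⟨r, hr⟩ := output_prefix_of_reaches h
  rw [← hr, List.getElem?_append_left (List.getElem?_eq_some_iff.1 hv).1, hv]

theorem reaches_of_step_eq_none {c d : M.Cfg} (hc : Reaches (M.step x) M.init c)
    (hd : Reaches (M.step x) M.init d) (hd₀ : M.step x d = none) : Reaches (M.step x) c d := by
  have hmem := StateTransition.mem_eval.2 ⟨hd, hd₀⟩
  rw [StateTransition.reaches_eval hc] at hmem
  exact (StateTransition.mem_eval.1 hmem).1

theorem Computes.cell_eq (h : M.Computes x y) {c : M.Cfg} (hc : Reaches (M.step x) M.init c)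
    {m : ℕ} {v : A} (hv : c.output[m]? = some v) : y.cell m = some v := by
  cases κ₀ with
  | word =>
    obtain ⟨d, hd, hd₀, rfl⟩ := h
    exact getElem?_output_of_reaches (reaches_of_step_eq_none hc hd hd₀) hv
  | seq =>
    obtain ⟨d, hd, hdm⟩ := h m
    rcases StateTransition.reaches_total hc hd with hcd | hdc
    · exact hdm.symm.trans (getElem?_output_of_reaches hcd hv)
    · exact (getElem?_output_of_reaches hdc hdm).symm.trans hv

theorem Computes.cell_eq_of_step_eq_none (h : M.Computes x y) {c : M.Cfg}
    (hc : Reaches (M.step x) M.init c) (hc₀ : M.step x c = none) (m : ℕ) :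
    y.cell m = c.output[m]? := by
  cases κ₀ with
  | word =>
    obtain ⟨d, hd, hd₀, rfl⟩ := h
    rw [Part.mem_unique (StateTransition.mem_eval.2 ⟨hc, hc₀⟩)
      (StateTransition.mem_eval.2 ⟨hd, hd₀⟩)]
    rfl
  | seq =>
    obtain ⟨d, hd, hdm⟩ := h m
    exact (getElem?_output_of_reaches (reaches_of_step_eq_none hd hc hc₀) hdm).symm

theorem Computes.approximates_approxOutput (h : M.Computes x y)
    (ha : ∀ j, Approximates (a j) (x j)) (t : ℕ) : Approximates (M.approxOutput t a) y := by
  intro m v hv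
  rw [approxOutput, List.getElem?_append] at hv
  split_ifs at hv with hm hhalt
  · rw [List.getElem?_map] at hv
    obtain ⟨w, hw, rfl⟩ := Option.map_eq_some_iff.1 hv
    exact h.cell_eq (reaches_listRun ha t) hw
  · have hstep : M.step x (M.listRun a t).toCfg = none := by
      rw [ListCfg.step_toCfg ha hhalt.1, hhalt.2, Option.map_none]
    rw [h.cell_eq_of_step_eq_none (reaches_listRun ha t) hstep,
      (List.mem_replicate.1 (List.mem_of_getElem? hv)).2]
    exact List.getElem?_eq_none (not_lt.1 fun h => hm (by rwa [List.length_map]))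
  · simp at hv

section Eventually

variable {a : ℕ → Fin n → Approx A}

theorem eventually_known (ha : ∀ j, ConvergesTo (fun t => a t j) (x j)) {E : ℕ → M.ListCfg}
    {c : M.Cfg} (hE : ∀ᶠ t in atTop, (E t).toCfg = c) :
    ∀ᶠ t in atTop, ((E t).view (a t)).Known := by
  filter_upwards [hE, eventually_all.2 fun j => (ha j).eventually_lt_length (c.pos j)]
    with t ht hlen j
  subst ht
  exact Option.isSome_iff_exists.2 ⟨_, List.getElem?_eq_getElem (hlen j)⟩

theorem exists_eventually_listRun_eq (ha : ∀ j, ConvergesTo (fun t => a t j) (x j)) {d : M.Cfg}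
    (hd : Reaches (M.step x) M.init d) :
    ∃ N, ∀ᶠ t in atTop, (M.listRun (a t) N).toCfg = d := by
  induction hd with
  | refl => exact ⟨0, .of_forall fun _ => rfl⟩
  | @tail c d _ hcd ih =>
    obtain ⟨N, hN⟩ := ih
    refine ⟨N + 1, ?_⟩
    filter_upwards [hN, eventually_known ha hN] with t ht hknown
    subst ht
    rw [Option.mem_def, ListCfg.step_toCfg (fun j => (ha j).approximates t) hknown] at hcd
    obtain ⟨α, hα, rfl⟩ := Option.map_eq_some_iff.1 hcd
    rw [listRun_succ, ListCfg.next, if_pos hknown, hα, Option.elim_some]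

theorem eventually_reaches_listRun_self (ha : ∀ j, ConvergesTo (fun t => a t j) (x j)) {d : M.Cfg}
    (hd : Reaches (M.step x) M.init d) :
    ∀ᶠ t in atTop, Reaches (M.step x) d (M.listRun (a t) t).toCfg := by
  obtain ⟨N, hN⟩ := exists_eventually_listRun_eq ha hd
  filter_upwards [hN, eventually_ge_atTop N] with t ht hNt
  exact ht ▸ reaches_listRun_of_le (fun j => (ha j).approximates t) hNt

theorem Computes.eventually_lt_length_approxOutput (h : M.Computes x y)
    (ha : ∀ j, ConvergesTo (fun t => a t j) (x j)) (m : ℕ) :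
    ∀ᶠ t in atTop, m < (M.approxOutput t (a t)).length := by
  cases κ₀ with
  | word =>
    obtain ⟨d, hd, hd₀, -⟩ := h
    have run_eq : ∀ᶠ t in atTop, (M.listRun (a t) t).toCfg = d := by
      filter_upwards [eventually_reaches_listRun_self ha hd] with t ht
      exact (StateTransition.eval_maximal (StateTransition.mem_eval.2 ⟨hd, hd₀⟩)).1 ht
    filter_upwards [run_eq, eventually_known ha run_eq, eventually_gt_atTop m] with t ht hknown hm
    subst ht
    rw [ListCfg.step_toCfg (fun j => (ha j).approximates t) hknown,
      Option.map_eq_none_iff] at hd₀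
    rw [approxOutput, if_pos ⟨hknown, hd₀⟩, List.length_append, List.length_replicate]
    omega
  | seq =>
    obtain ⟨d, hd, hdm⟩ := h m
    filter_upwards [eventually_reaches_listRun_self ha hd] with t ht
    rw [approxOutput, List.length_append, List.length_map]
    exact Nat.lt_add_right _
      (List.getElem?_eq_some_iff.1 (getElem?_output_of_reaches ht hdm)).1

end Eventually

theorem tracks_approxOutput :
    Tracks M.approxOutput fun x : ∀ j, Names A (κ j) => {y : Names A κ₀ | M.Computes x y} :=
  fun _ _ hy _ ha => ⟨fun t => hy.approximates_approxOutput (fun j => (ha j).approximates t) t,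
    hy.eventually_lt_length_approxOutput ha⟩

end Correctness

section Primrec

variable [Primcodable A] [Primcodable M.Q] [Primcodable M.S]

theorem primrec_moveInput (d : Option Turing.Dir) : Primrec (moveInput d) := by
  rcases d with _ | _ | _
  · exact Primrec.id
  · exact Primrec.pred
  · exact Primrec.succ

theorem ListCfg.primrec_view :
    Primrec₂ fun (a : Fin n → Approx A) (c : M.ListCfg) => c.view a := by
  have pos (j : Fin n) : Primrec fun p : (Fin n → Approx A) × M.ListCfg => p.2.pos j :=
    primrec_apply (Primrec.fst.comp (Primrec.snd.comp Primrec.snd)) j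
  have work (j : Fin M.w) : Primrec fun p : (Fin n → Approx A) × M.ListCfg => p.2.work j :=
    primrec_apply (Primrec.fst.comp (Primrec.snd.comp (Primrec.snd.comp Primrec.snd))) j
  exact (Primrec.fst.comp Primrec.snd).pair
    ((primrec_pi fun j => Primrec.list_getElem?.comp (primrec_apply Primrec.fst j) (pos j)).pair
      (primrec_pi fun j => Primrec.fst.comp (Primrec.snd.comp (work j))))

theorem ListCfg.primrec_act (α : Type2Action A n M.w M.Q M.S) :
    Primrec fun c : M.ListCfg => c.act α := by
  have pos (j : Fin n) : Primrec fun c : M.ListCfg => c.pos j :=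
    primrec_apply (Primrec.fst.comp Primrec.snd) j
  have work (j : Fin M.w) : Primrec fun c : M.ListCfg => c.work j :=
    primrec_apply (Primrec.fst.comp (Primrec.snd.comp Primrec.snd)) j
  have output : Primrec fun c : M.ListCfg => c.output :=
    Primrec.snd.comp (Primrec.snd.comp Primrec.snd)
  exact (Primrec.const _).pair ((primrec_pi fun j => (primrec_moveInput _).comp (pos j)).pair
    ((primrec_pi fun j => (ListTape.primrec_writeMove _ _).comp (work j)).pair
      (Primrec.list_append.comp output (Primrec.const _))))

theorem ListCfg.primrec_next [Finite A] :
    Primrec₂ fun (a : Fin n → Approx A) (c : M.ListCfg) => c.next a := by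
  classical
  have next_of_view : Primrec₂ fun (v : M.View) (c : M.ListCfg) =>
      if v.Known then v.action.elim c c.act else c := by
    refine primrec₂_of_finite fun v => ?_
    split_ifs
    · cases v.action with
      | none => exact Primrec.id
      | some α => exact primrec_act α
    · exact Primrec.id
  exact next_of_view.comp primrec_view Primrec.snd

end Primrec

theorem primrec_approxOutput [Finite A] [Primcodable A] (M : Type2Machine A n) :
    Primrec₂ M.approxOutput := by
  classical
  let _ : Primcodable M.Q := primcodableOfFinite _
  let _ : Primcodable M.S := primcodableOfFinite _
  have run : Primrec fun p : ℕ × (Fin n → Approx A) => M.listRun p.2 p.1 :=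
    Primrec.nat_iterate Primrec.fst (Primrec.const _)
      (ListCfg.primrec_next.comp₂ (Primrec.snd.comp₂ Primrec₂.left) Primrec₂.right)
  have output : Primrec fun p : ℕ × (Fin n → Approx A) => (M.listRun p.2 p.1).output :=
    Primrec.snd.comp (Primrec.snd.comp (Primrec.snd.comp run))
  have halted : PrimrecPred fun v : M.View => v.Known ∧ v.action = none :=
    (Primrec.dom_finite fun v : M.View => decide (v.Known ∧ v.action = none)).primrecPred
  have blanks : Primrec fun t : ℕ => List.replicate t (none : Option A) :=
    (Primrec.list_map Primrec.list_range (Primrec₂.const none)).of_eq fun t => by simp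
  exact Primrec.list_append.comp
    (Primrec.list_map output (Primrec.option_some.comp₂ Primrec₂.right))
    (Primrec.ite (halted.comp (ListCfg.primrec_view.comp Primrec.snd run))
      (blanks.comp Primrec.fst) (Primrec.const []))

end Type2Machine

/-! ## Type-2 machines that evaluate codes -/

section Stacks

open Turing

variable {Γ : Type}

/-- The tape that holds a stack; the head scans the top of the stack. -/
def stackTape (l : List Γ) : Tape (Option Γ) :=
  ⟨l.head?, ListBlank.mk (l.tail.map some), ListBlank.mk []⟩

/-- The tape that holds a stack, with the head on the blank cell to the right of the top. -/
def shiftedStackTape (l : List Γ) : Tape (Option Γ) :=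
  ⟨none, ListBlank.mk (l.map some), ListBlank.mk []⟩

theorem listBlank_mk_singleton_default {S : Type} [Inhabited S] :
    ListBlank.mk [(default : S)] = ListBlank.mk [] :=
  Quotient.sound' (.inr ⟨1, rfl⟩)

theorem moveWork_right_stackTape (l : List Γ) :
    Type2Machine.moveWork (some .right) ((stackTape l).write l.head?) = shiftedStackTape l := by
  cases l with
  | nil => exact congrArg (Tape.mk none · _) listBlank_mk_singleton_default
  | cons a l => rfl

theorem moveWork_left_stackTape (l : List Γ) :
    Type2Machine.moveWork (some .left) ((stackTape l).write none) = stackTape l.tail := by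
  rcases l with _ | ⟨a, _ | ⟨b, l⟩⟩ <;>
    exact congrArg (Tape.mk _ _) listBlank_mk_singleton_default

theorem moveWork_none_shiftedStackTape (l : List Γ) (a : Γ) :
    Type2Machine.moveWork none ((shiftedStackTape l).write (some a)) = stackTape (a :: l) :=
  rfl

end Stacks

/-- What a machine does at the end of a stage: nothing (`none`), halt (`some none`), or write `a` on
the output tape (`some (some a)`). This is the information about a cell of the result that an
approximation of the result contains. -/
abbrev Response (A : Type*) := Option (Option A)

/-- A memory-updating function for each tuple of symbols that are read from the input tapes in a
stage. Its value at the list of numbers that form the memory consists of the number of a response,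
followed by the new memory. -/
abbrev CodeTransducer (A : Type*) (k : ℕ) := (Fin k → Option A) → Turing.ToPartrec.Code

namespace CodeTransducer

open Turing Turing.PartrecToTM2 Turing.ToPartrec

/-- The statements of the stack machines that evaluate codes. -/
abbrev StackStmt := TM2.Stmt (fun _ : K' => Γ') Λ' (Option Γ')

/-- The phases of a stage: reading a symbol from each input tape, running a stack machine (a push
takes two steps, and `moved` tells whether the first one has been performed), and removing the
number of the response from the main stack, where `l` is the part that has been removed. -/
inductive Phase
  | read
  | run (s : StackStmt) (v : Option Γ') (moved : Bool)
  | emit (l : List Γ')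

/-- What to do in one step: the next phase, the stack whose tape is changed, with the symbol to be
written and the movement of the head, the movement of all heads on the input tapes, and the symbol
to be written on the output tape. -/
structure Instr (A : Type*) where
  next : Phase
  stackOp : Option (K' × Option Γ' × Option Dir) := none
  inputMove : Option Dir := none
  out : Option A := none

/-- The numbering of the stacks by the work tapes on which they are kept. -/
def stackEquiv : Fin 4 ≃ K' where
  toFun := ![.main, .rev, .aux, .stack]
  invFun | .main => 0 | .rev => 1 | .aux => 2 | .stack => 3
  left_inv := by decide
  right_inv := by rintro (_ | _ | _ | _) <;> rfl

/-- The tapes that hold the stacks. -/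
def tapes (S : K' → List Γ') (K : K') : Tape (Option Γ') := stackTape (S K)

/-- The tapes with the main stack `l`, the other stacks being empty. -/
def mainTapes (l : List Γ') : K' → Tape (Option Γ') := tapes (K'.elim l [] [] [])

/-- The number with a given binary notation, in the format of `Turing.PartrecToTM2.trNat`. -/
def ofBinary : List Γ' → ℕ
  | [] => 0
  | .bit1 :: l => ofBinary l + ofBinary l + 1
  | _ :: l => ofBinary l + ofBinary l

theorem ofBinary_trPosNum (p : PosNum) : ofBinary (trPosNum p) = p := by
  induction p with
  | one => rfl
  | bit1 p ih => rw [trPosNum, ofBinary, ih, PosNum.cast_bit1]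
  | bit0 p ih => rw [trPosNum, ofBinary, ih, PosNum.cast_bit0]; simp

theorem ofBinary_trNat (n : ℕ) : ofBinary (trNat n) = n := by
  conv_rhs => rw [← Num.to_of_nat n]
  rw [trNat]
  cases (n : Num) with
  | zero => rfl
  | pos p => exact ofBinary_trPosNum p

theorem update_tapes (S : K' → List Γ') (K : K') (l : List Γ') :
    Function.update (tapes S) K (stackTape l) = tapes (Function.update S K l) :=
  (Function.comp_update stackTape S K l).symm

theorem moveWork_write_eq_update (T : K' → Tape (Option Γ')) (K L : K') (s : Option Γ')
    (d : Option Dir) :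
    Type2Machine.moveWork (if L = K then d else none)
      ((T L).write (if L = K then s else (T L).head)) =
      Function.update T K (Type2Machine.moveWork d ((T K).write s)) L := by
  by_cases h : L = K
  · rw [if_pos h, if_pos h, h, Function.update_self]
  · rw [if_neg h, if_neg h, Function.update_of_ne h, Tape.write_self]
    rfl

variable {A : Type*} {k : ℕ}

section Machine

variable [Primcodable A] (C : CodeTransducer A k)

/-- The phases that may occur. -/
def phases : Set Phase :=
  {.read} ∪ (⋃ i, ⋃ l ∈ codeSupp (C i) .halt, ⋃ s ∈ TM2.stmts₁ (tr l),
    Set.range fun p : Option Γ' × Bool => .run s p.1 p.2) ∪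
    ⋃ r : Response A, .emit '' {l | l <+: trNat (Encodable.encode r)}

theorem read_mem_phases : .read ∈ C.phases :=
  .inl (.inl rfl)

theorem run_mem_phases {i : Fin k → Option A} {l : Λ'} (hl : l ∈ codeSupp (C i) .halt)
    {s : StackStmt} (hs : s ∈ TM2.stmts₁ (tr l)) (v : Option Γ') (b : Bool) :
    .run s v b ∈ C.phases := by
  refine .inl (.inr ?_)
  simp only [Set.mem_iUnion]
  exact ⟨i, l, hl, s, hs, (v, b), rfl⟩

theorem emit_mem_phases {r : Response A} {l : List Γ'} (hl : l <+: trNat (Encodable.encode r)) :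
    .emit l ∈ C.phases :=
  .inr (Set.mem_iUnion.2 ⟨r, l, hl, rfl⟩)

theorem finite_phases [Finite A] : C.phases.Finite := by
  refine ((Set.finite_singleton _).union (Set.finite_iUnion fun i =>
    (Finset.finite_toSet _).biUnion fun l _ => (Finset.finite_toSet _).biUnion fun s _ =>
      Set.finite_range _)).union (Set.finite_iUnion fun r => Set.Finite.image _ ?_)
  exact (List.finite_toSet (trNat (Encodable.encode r)).inits).subset fun l hl =>
    (List.mem_inits l _).2 hl

/-- The program on phases, depending on the symbols on the input tapes and the tops of the
stacks. -/
def prog : Phase → (Fin k → Option A) → (K' → Option Γ') → Option (Instr A)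
  | .read, i, _ =>
      some { next := .run (tr (trNormal (C i) .halt)) none false, inputMove := some .right }
  | .run (.push K f s) v false, _, h =>
      some { next := .run (.push K f s) v true, stackOp := some (K, h K, some .right) }
  | .run (.push K f s) v true, _, _ =>
      some { next := .run s v false, stackOp := some (K, some (f v), none) }
  | .run (.peek K f s) v _, _, h => some { next := .run s (f v (h K)) false }
  | .run (.pop K f s) v _, _, h =>
      some { next := .run s (f v (h K)) false, stackOp := some (K, none, some .left) }
  | .run (.load f s) v _, _, _ => some { next := .run s (f v) false }
  | .run (.branch f s₁ s₂) v _, _, _ => some { next := .run (cond (f v) s₁ s₂) v false }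
  | .run (.goto f) v _, _, _ => some { next := .run (tr (f v)) v false }
  | .run .halt _ _, _, _ => some { next := .emit [] }
  | .emit l, _, h =>
      match h .main, (Encodable.decode (ofBinary l) : Option (Response A)).join with
      | none, _ => none
      | some .cons, some none => none
      | some .cons, r =>
          some { next := .read, stackOp := some (.main, none, some .left), out := r.join }
      | some s, _ =>
          some { next := .emit (l ++ [s]), stackOp := some (.main, none, some .left) }

theorem prog_emit_encode_halt (i : Fin k → Option A) {h : K' → Option Γ'}
    (hh : h .main = some .cons) :
    C.prog (.emit (trNat (Encodable.encode (some none : Response A)))) i h = none := by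
  simp only [prog, hh, ofBinary_trNat, Encodable.encodek, Option.join_some]

theorem prog_emit_encode_of_ne {r : Response A} (hr : r ≠ some none) (i : Fin k → Option A)
    {h : K' → Option Γ'} (hh : h .main = some .cons) :
    C.prog (.emit (trNat (Encodable.encode r))) i h =
      some { next := .read, stackOp := some (.main, none, some .left), out := r.join } := by
  simp only [prog, hh, ofBinary_trNat, Encodable.encodek, Option.join_some]

open Classical in
/-- A phase as a state of the machine. -/
noncomputable def toState (q : Phase) : C.phases :=
  if h : q ∈ C.phases then ⟨q, h⟩ else ⟨.read, C.read_mem_phases⟩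

/-- The action of the machine that corresponds to an instruction, if `h` are the symbols scanned on
the work tapes. -/
noncomputable def toAction (h : Fin 4 → Option Γ') (I : Instr A) :
    Type2Action A k 4 C.phases (Option Γ') where
  next := C.toState I.next
  inputMove _ := I.inputMove
  write j := I.stackOp.elim (h j) fun p => if stackEquiv j = p.1 then p.2.1 else h j
  workMove j := I.stackOp.elim none fun p => if stackEquiv j = p.1 then p.2.2 else none
  out := I.out

variable [Finite A]

/-- The Type-2 machine that evaluates a code in each stage. -/
noncomputable def machine : Type2Machine A k where
  Q := C.phases
  finQ := C.finite_phases
  S := Option Γ'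
  w := 4
  start := C.toState .read
  prog q i h := (C.prog q.1 i fun K => h (stackEquiv.symm K)).map (C.toAction h)

/-- The configuration with phase `q`, all input heads on cell `t`, and tapes `T` for the stacks. -/
noncomputable def cfg (q : Phase) (t : ℕ) (T : K' → Tape (Option Γ')) (out : List A) :
    C.machine.Cfg :=
  ⟨C.toState q, fun _ => t, fun j => T (stackEquiv j), out⟩

/-- The configuration after executing an instruction. -/
noncomputable def exec (I : Instr A) (t : ℕ) (T : K' → Tape (Option Γ')) (out : List A) :
    C.machine.Cfg :=
  C.cfg I.next (Type2Machine.moveInput I.inputMove t)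
    (I.stackOp.elim T fun p =>
      Function.update T p.1 (Type2Machine.moveWork p.2.2 ((T p.1).write p.2.1)))
    (out ++ I.out.toList)

variable {C} {κ : Fin k → NameKind} {x : ∀ j, Names A (κ j)} {t : ℕ} {out : List A}

theorem step_cfg {q : Phase} (hq : q ∈ C.phases) (T : K' → Tape (Option Γ')) :
    C.machine.step x (C.cfg q t T out) =
      (C.prog q (fun j => (x j).cell t) fun K => (T K).head).map fun I => C.exec I t T out := by
  have toState_val : (C.toState q).1 = q := by rw [toState, dif_pos hq]
  have scanned_eq : (fun K => (T (stackEquiv (stackEquiv.symm K))).head) = fun K => (T K).head := by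
    simp only [Equiv.apply_symm_apply]
  have prog_eq : C.prog (C.toState q).1 (fun j => (x j).cell t)
      (fun K => (T (stackEquiv (stackEquiv.symm K))).head) =
      C.prog q (fun j => (x j).cell t) fun K => (T K).head := by rw [toState_val, scanned_eq]
  refine (congrArg (fun o => Option.map _ (Option.map _ o)) prog_eq).trans
    ((Option.map_map _ _ _).trans (congrArg (Option.map · _) (funext fun I => ?_)))
  obtain ⟨q', _ | ⟨K, s, d⟩, m, o⟩ := I
  · exact congrArg (Type2Machine.Cfg.mk _ _ · _) (funext fun j => Tape.write_self _)
  · exact congrArg (Type2Machine.Cfg.mk _ _ · _)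
      (funext fun j => moveWork_write_eq_update T K (stackEquiv j) s d)

theorem step_cfg_of_prog_eq_some {q : Phase} (hq : q ∈ C.phases) {T : K' → Tape (Option Γ')}
    {I : Instr A} (h : (C.prog q (fun j => (x j).cell t) fun K => (T K).head) = some I) :
    C.machine.step x (C.cfg q t T out) = some (C.exec I t T out) := by
  rw [step_cfg hq, h, Option.map_some]

/-- The configuration of the machine that corresponds to a configuration of a stack machine. -/
noncomputable def ofStackCfg (C : CodeTransducer A k) (t : ℕ) (out : List A) :
    TM2.Cfg (fun _ : K' => Γ') Λ' (Option Γ') → C.machine.Cfg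
  | ⟨some l, v, S⟩ => C.cfg (.run (tr l) v false) t (tapes S) out
  | ⟨none, _, S⟩ => C.cfg (.emit []) t (tapes S) out

theorem step_cfg_of_prog_eq_next {q q' : Phase} (hq : q ∈ C.phases) {T : K' → Tape (Option Γ')}
    (h : C.prog q (fun j => (x j).cell t) (fun K => (T K).head) = some { next := q' }) :
    C.machine.step x (C.cfg q t T out) = some (C.cfg q' t T out) :=
  (step_cfg_of_prog_eq_some hq h).trans
    (congrArg (fun out => some (C.cfg q' t T out)) (List.append_nil _))

theorem step_cfg_of_prog_eq_pop {q q' : Phase} (hq : q ∈ C.phases) {S : K' → List Γ'} {K : K'}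
    {o : Option A} (h : C.prog q (fun j => (x j).cell t) (fun K => (S K).head?) =
      some { next := q', stackOp := some (K, none, some .left), out := o }) :
    C.machine.step x (C.cfg q t (tapes S) out) =
      some (C.cfg q' t (tapes (Function.update S K (S K).tail)) (out ++ o.toList)) := by
  rw [← update_tapes, ← moveWork_left_stackTape]
  exact step_cfg_of_prog_eq_some hq (T := tapes S) h

theorem reaches_push {K : K'} {f : Option Γ' → Γ'} {s : StackStmt} {v : Option Γ'}
    (hs : ∀ b, .run (.push K f s) v b ∈ C.phases) (S : K' → List Γ') :
    Reaches (C.machine.step x) (C.cfg (.run (.push K f s) v false) t (tapes S) out)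
      (C.cfg (.run s v false) t (tapes (Function.update S K (f v :: S K))) out) := by
  refine .head (step_cfg_of_prog_eq_some (hs _) rfl)
    (.single ((step_cfg_of_prog_eq_some (hs _) rfl).trans (congrArg some ?_)))
  simp only [exec, Option.elim_some, Option.toList_none, List.append_nil, Function.update_self,
    Function.update_idem, Type2Machine.moveInput]
  rw [← update_tapes, ← moveWork_none_shiftedStackTape, ← moveWork_right_stackTape]
  rfl

theorem reaches_stepAux {s : StackStmt}
    (hs : ∀ s' ∈ TM2.stmts₁ s, ∀ v b, .run s' v b ∈ C.phases) (v : Option Γ')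
    (S : K' → List Γ') :
    Reaches (C.machine.step x) (C.cfg (.run s v false) t (tapes S) out)
      (C.ofStackCfg t out (TM2.stepAux s v S)) := by
  induction s generalizing v S with
  | push K f s ih =>
    exact (reaches_push (hs _ TM2.stmts₁_self v) S).trans
      (ih (fun s' hs' => hs s' (by simp [TM2.stmts₁, hs'])) _ _)
  | peek K f s ih =>
    refine .head (step_cfg_of_prog_eq_next (hs _ TM2.stmts₁_self _ _) rfl) ?_
    exact ih (fun s' hs' => hs s' (by simp [TM2.stmts₁, hs'])) _ _
  | pop K f s ih =>
    refine .head (step_cfg_of_prog_eq_pop (hs _ TM2.stmts₁_self _ _) rfl) ?_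
    rw [Option.toList_none, List.append_nil]
    exact ih (fun s' hs' => hs s' (by simp [TM2.stmts₁, hs'])) _ _
  | load f s ih =>
    refine .head (step_cfg_of_prog_eq_next (hs _ TM2.stmts₁_self _ _) rfl) ?_
    exact ih (fun s' hs' => hs s' (by simp [TM2.stmts₁, hs'])) _ _
  | branch f s₁ s₂ ih₁ ih₂ =>
    refine .head (step_cfg_of_prog_eq_next (hs _ TM2.stmts₁_self _ _) rfl) ?_
    rw [TM2.stepAux]
    cases f v
    · exact ih₂ (fun s' hs' => hs s' (by simp [TM2.stmts₁, hs'])) _ _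
    · exact ih₁ (fun s' hs' => hs s' (by simp [TM2.stmts₁, hs'])) _ _
  | goto f => exact .single (step_cfg_of_prog_eq_next (hs _ TM2.stmts₁_self _ _) rfl)
  | halt => exact .single (step_cfg_of_prog_eq_next (hs _ TM2.stmts₁_self _ _) rfl)

theorem reaches_ofStackCfg {i : Fin k → Option A} {c d : TM2.Cfg (fun _ : K' => Γ') Λ' (Option Γ')}
    (hc : c.l ∈ Finset.insertNone (codeSupp (C i) .halt)) (hd : Reaches (TM2.step tr) c d) :
    Reaches (C.machine.step x) (C.ofStackCfg t out c) (C.ofStackCfg t out d) := by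
  have hsupp := tr_supports (C i) .halt
  induction hd using Relation.ReflTransGen.head_induction_on with
  | refl => exact .refl
  | @head c e hce _ ih =>
    obtain ⟨_ | l, v, S⟩ := c
    · cases hce
    · have hl : l ∈ codeSupp (C i) .halt := Finset.some_mem_insertNone.1 hc
      have he : e.l ∈ Finset.insertNone (codeSupp (C i) .halt) :=
        let _ : Inhabited Λ' := ⟨l⟩
        TM2.step_supports tr ⟨hl, hsupp.2⟩ hce hc
      obtain rfl : TM2.stepAux (tr l) v S = e := Option.some.inj hce
      exact (reaches_stepAux (fun _ => C.run_mem_phases hl) v S).trans (ih he)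

/-- Configurations at the beginning of stage `t`, if the numbers `v` form the memory. -/
noncomputable def stageCfg (C : CodeTransducer A k) (t : ℕ) (v : List ℕ) (out : List A) :
    C.machine.Cfg :=
  C.cfg .read t (mainTapes (trList v)) out

variable {v w : List ℕ} {r : Response A}

theorem reaches_of_mem_eval (h : w ∈ (C fun j => (x j).cell t).eval v) :
    Reaches (C.machine.step x) (C.stageCfg t v out)
      (C.cfg (.emit []) (t + 1) (mainTapes (trList w)) out) := by
  have hhalt : halt w ∈ StateTransition.eval (TM2.step tr) (init (C fun j => (x j).cell t) v) := by
    rw [tr_eval]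
    exact (Part.mem_map_iff _).2 ⟨w, h, rfl⟩
  have hread : C.machine.step x (C.stageCfg t v out) =
      some (C.ofStackCfg (t + 1) out (init (C fun j => (x j).cell t) v)) :=
    (step_cfg_of_prog_eq_some C.read_mem_phases rfl).trans
      (congrArg (fun out => some (C.cfg _ _ _ out)) (List.append_nil _))
  exact .head hread (reaches_ofStackCfg
    (Finset.some_mem_insertNone.2 (tr_supports _ .halt).1) (StateTransition.mem_eval.1 hhalt).1)

theorem step_emit_of_ne_cons {l : List Γ'} (hl : .emit l ∈ C.phases) {s : Γ'} (hs : s ≠ .cons)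
    (rest : List Γ') :
    C.machine.step x (C.cfg (.emit l) t (mainTapes (s :: rest)) out) =
      some (C.cfg (.emit (l ++ [s])) t (mainTapes rest) out) := by
  refine (step_cfg_of_prog_eq_pop (q' := .emit (l ++ [s])) (K := .main) (o := none) hl ?_).trans ?_
  · cases s <;> first | rfl | exact absurd rfl hs
  · rw [K'.elim_update_main, Option.toList_none, List.append_nil]
    rfl

theorem reaches_emit {l l' rest : List Γ'} (hl' : ∀ s ∈ l', natEnd s = false)
    (hl : ∀ p, p <+: l ++ l' → .emit p ∈ C.phases) :
    Reaches (C.machine.step x) (C.cfg (.emit l) t (mainTapes (l' ++ rest)) out)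
      (C.cfg (.emit (l ++ l')) t (mainTapes rest) out) := by
  induction l' generalizing l with
  | nil =>
    rw [List.append_nil]
    exact .refl
  | cons s l' ih =>
    have hs : s ≠ .cons := by
      rintro rfl
      exact Bool.noConfusion (hl' _ List.mem_cons_self)
    rw [List.append_cons] at hl ⊢
    exact .head (step_emit_of_ne_cons (hl l ((List.prefix_append _ _).trans
      (List.prefix_append _ _))) hs (l' ++ rest))
      (ih (fun s' hs' => hl' s' (List.mem_cons_of_mem _ hs')) hl)

theorem reaches_emit_encode (h : Encodable.encode r :: w ∈ (C fun j => (x j).cell t).eval v) :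
    Reaches (C.machine.step x) (C.stageCfg t v out)
      (C.cfg (.emit (trNat (Encodable.encode r))) (t + 1) (mainTapes (.cons :: trList w)) out) :=
  (reaches_of_mem_eval h).trans
    (reaches_emit (l := []) (trNat_natEnd _) fun _ => C.emit_mem_phases)

theorem reaches_stageCfg_succ (h : Encodable.encode r :: w ∈ (C fun j => (x j).cell t).eval v)
    (hr : r ≠ some none) :
    Reaches (C.machine.step x) (C.stageCfg t v out)
      (C.stageCfg (t + 1) w (out ++ r.join.toList)) := by
  refine (reaches_emit_encode h).tail ((step_cfg_of_prog_eq_pop (C.emit_mem_phases List.prefix_rfl)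
    (C.prog_emit_encode_of_ne hr _ rfl)).trans ?_)
  rw [K'.elim_update_main]
  rfl

theorem exists_reaches_step_eq_none
    (h : Encodable.encode (some none : Response A) :: w ∈ (C fun j => (x j).cell t).eval v) :
    ∃ c, Reaches (C.machine.step x) (C.stageCfg t v out) c ∧ C.machine.step x c = none ∧
      c.output = out := by
  refine ⟨_, reaches_emit_encode h, ?_, rfl⟩
  rw [step_cfg (C.emit_mem_phases List.prefix_rfl), C.prog_emit_encode_halt _ rfl, Option.map_none]

theorem init_machine (C : CodeTransducer A k) : C.machine.init = C.stageCfg 0 [] [] :=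
  congrArg (Type2Machine.Cfg.mk _ _ · _) (funext fun j => by fin_cases j <;> rfl)

end Machine

end CodeTransducer

/-! ## Primitive recursive transducers -/

section Codes

open Turing.ToPartrec

theorem exists_code_of_primrec {f : ℕ → ℕ} (hf : Primrec f) :
    ∃ c : Code, ∀ v, c.eval v = pure [f v.headI] := by
  obtain ⟨c, hc⟩ := Code.exists_code (n := 1) (Nat.Partrec'.of_prim (hf.comp Primrec.vector_head))
  refine ⟨c.comp Code.head, fun v => ?_⟩
  have eval_singleton : c.eval [v.headI] = pure [f v.headI] :=
    (hc (v.headI ::ᵥ List.Vector.nil)).trans (Part.map_some _ _)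
  simp only [Code.comp_eval, Code.head_eval]
  exact (Part.bind_some _ _).trans eval_singleton

theorem exists_code_pair {f g : ℕ → ℕ} (hf : Primrec f) (hg : Primrec g) :
    ∃ c : Code, ∀ v, c.eval v = pure [f v.headI, g v.headI] := by
  obtain ⟨c, hc⟩ := exists_code_of_primrec hf
  obtain ⟨d, hd⟩ := exists_code_of_primrec hg
  refine ⟨c.cons d, fun v => ?_⟩
  simp only [Code.cons_eval, hc, hd, LawfulMonad.pure_bind, List.headI_cons]

end Codes

/-- A process that reads the input tapes from left to right, one symbol of each tape in a stage, and
writes at most one symbol on the output tape in a stage. In contrast to a Type-2 machine, it may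
have infinitely many states. -/
structure Transducer (A : Type*) (k : ℕ) (α : Type*) where
  /-- the initial content of the memory -/
  init : α
  /-- the response and the new content of the memory -/
  step : (Fin k → Option A) → α → Response A × α

namespace Transducer

variable {A α : Type*} {k : ℕ} {κ : Fin k → NameKind} (T : Transducer A k α)
  (x : ∀ j, Names A (κ j))

/-- The content of the memory and the word on the output tape at the beginning of stage `t`, if the
transducer does not halt. -/
def run : ℕ → α × List A
  | 0 => (T.init, [])
  | t + 1 =>
    let z := T.step (fun j => (x j).cell t) (run t).1
    (z.2, (run t).2 ++ z.1.join.toList)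

/-- The response of the transducer in stage `t`. -/
def response (t : ℕ) : Response A := (T.step (fun j => (x j).cell t) (T.run x t).1).1

/-- The transducer halts in stage `t`. -/
def HaltsAt (t : ℕ) : Prop := T.response x t = some none ∧ ∀ s < t, T.response x s ≠ some none

section Codes

variable [Primcodable α]

/-- The memory content with a given number. As the stacks of the machine that evaluates codes are
empty at the beginning, `0` stands for the initial content. -/
def decodeMemory (m : ℕ) : α := ((Encodable.decode m : Option (Option α)).join).getD T.init

theorem decodeMemory_zero : T.decodeMemory 0 = T.init := by
  have decode_zero : (Encodable.decode 0 : Option (Option α)) = some none :=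
    Encodable.encodek (none : Option α)
  rw [decodeMemory, decode_zero]
  rfl

theorem decodeMemory_encode (m : α) : T.decodeMemory (Encodable.encode (some m)) = m := by
  rw [decodeMemory, Encodable.encodek]
  rfl

variable [Primcodable A]

/-- The codes `C` compute the steps of `T`. -/
def IsEvaluatedBy (C : CodeTransducer A k) : Prop := ∀ i v, (C i).eval v =
  pure [Encodable.encode (T.step i (T.decodeMemory v.headI)).1,
    Encodable.encode (some (T.step i (T.decodeMemory v.headI)).2)]

variable {T} {x}

theorem exists_isEvaluatedBy (hT : ∀ i, Primrec (T.step i)) :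
    ∃ C : CodeTransducer A k, T.IsEvaluatedBy C := by
  have primrec_decodeMemory : Primrec T.decodeMemory :=
    Primrec.option_getD.comp (Primrec.option_bind Primrec.decode Primrec.snd.to₂) (Primrec.const _)
  have primrec_step (i : Fin k → Option A) : Primrec fun m => T.step i (T.decodeMemory m) :=
    (hT i).comp primrec_decodeMemory
  choose C hC using fun i => exists_code_pair
    (Primrec.encode.comp (Primrec.fst.comp (primrec_step i)))
    (Primrec.encode.comp (Primrec.option_some.comp (Primrec.snd.comp (primrec_step i))))
  exact ⟨C, hC⟩

variable {C : CodeTransducer A k}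

theorem IsEvaluatedBy.mem_eval (hC : T.IsEvaluatedBy C) {t : ℕ} {v : List ℕ}
    (hv : T.decodeMemory v.headI = (T.run x t).1) :
    [Encodable.encode (T.response x t), Encodable.encode (some (T.run x (t + 1)).1)] ∈
      (C fun j => (x j).cell t).eval v := by
  rw [hC, hv]
  exact Part.mem_some _

variable [Finite A]

theorem IsEvaluatedBy.exists_reaches_stageCfg (hC : T.IsEvaluatedBy C) (t : ℕ)
    (ht : ∀ s < t, T.response x s ≠ some none) :
    ∃ v : List ℕ, T.decodeMemory v.headI = (T.run x t).1 ∧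
      Reaches (C.machine.step x) C.machine.init (C.stageCfg t v (T.run x t).2) := by
  induction t with
  | zero =>
    refine ⟨[], T.decodeMemory_zero, ?_⟩
    rw [CodeTransducer.init_machine]
    exact .refl
  | succ t ih =>
    obtain ⟨v, hv, hreach⟩ := ih fun s hs => ht s (hs.trans t.lt_succ_self)
    exact ⟨[Encodable.encode (some (T.run x (t + 1)).1)], T.decodeMemory_encode _, hreach.trans
      (CodeTransducer.reaches_stageCfg_succ (hC.mem_eval hv) (ht t t.lt_succ_self))⟩

theorem IsEvaluatedBy.exists_reaches_output (hC : T.IsEvaluatedBy C) (t : ℕ)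
    (ht : ∀ s < t, T.response x s ≠ some none) :
    ∃ c, Reaches (C.machine.step x) C.machine.init c ∧ c.output = (T.run x t).2 :=
  let ⟨_, _, hreach⟩ := hC.exists_reaches_stageCfg t ht
  ⟨_, hreach, rfl⟩

theorem IsEvaluatedBy.exists_halting_cfg (hC : T.IsEvaluatedBy C) {t : ℕ} (ht : T.HaltsAt x t) :
    ∃ c, Reaches (C.machine.step x) C.machine.init c ∧ C.machine.step x c = none ∧
      c.output = (T.run x t).2 := by
  obtain ⟨v, hv, hreach⟩ := hC.exists_reaches_stageCfg t ht.2
  have heval := hC.mem_eval hv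
  rw [ht.1] at heval
  obtain ⟨c, hc, hstep, hout⟩ := CodeTransducer.exists_reaches_step_eq_none heval
  exact ⟨c, hreach.trans hc, hstep, hout⟩

end Codes

end Transducer

/-! ## Type-2 machines that compute limits of approximations -/

/-- The transducer that writes the symbols of a name whose approximations are computed by `H` from
the symbols that have been read. Its memory contains the number of completed stages, the symbols
that have been read, and the number of symbols that have been written. -/
def emitter {A : Type*} {k : ℕ} (H : ApproxFn A k) :
    Transducer A k (ℕ × (Fin k → Approx A) × ℕ) where
  init := (0, fun _ => [], 0)
  step i m :=
    let a j := m.2.1 j ++ [i j]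
    let r := (H (m.1 + 1) a)[m.2.2]?
    (r, m.1 + 1, a, m.2.2 + r.join.toList.length)

section Emitter

variable {A : Type*} {k : ℕ} {κ : Fin k → NameKind} {κ₀ : NameKind} {H : ApproxFn A k}
  {x : ∀ j, Names A (κ j)} {y : Names A κ₀}

theorem primrec_step_emitter [Finite A] [Primcodable A] (hH : Primrec₂ H) (i : Fin k → Option A) :
    Primrec ((emitter H).step i) := by
  have primrec_read : Primrec fun (m : ℕ × (Fin k → Approx A) × ℕ) j => m.2.1 j ++ [i j] :=
    primrec_pi fun j => Primrec.list_append.comp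
      (primrec_apply (Primrec.fst.comp Primrec.snd) j) (Primrec.const _)
  have primrec_written : Primrec fun m : ℕ × (Fin k → Approx A) × ℕ => m.2.2 :=
    Primrec.snd.comp Primrec.snd
  have primrec_stage : Primrec fun m : ℕ × (Fin k → Approx A) × ℕ => m.1 + 1 :=
    Primrec.succ.comp Primrec.fst
  have primrec_response := Primrec.list_getElem?.comp (hH.comp primrec_stage primrec_read)
    primrec_written
  have primrec_length : Primrec fun r : Response A => r.join.toList.length := Primrec.dom_finite _
  exact primrec_response.pair (primrec_stage.pair (primrec_read.pair
    (Primrec.nat_add.comp primrec_written (primrec_length.comp primrec_response))))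

theorem step_emitter (t n : ℕ) :
    (emitter H).step (fun j => (x j).cell t) (t, fun j => (x j).take t, n) =
      let r := (H (t + 1) fun j => (x j).take (t + 1))[n]?
      (r, t + 1, fun j => (x j).take (t + 1), n + r.join.toList.length) := by
  simp only [emitter, ← Names.take_succ]

theorem run_emitter_fst (t : ℕ) : ((emitter H).run x t).1 =
    (t, fun j => (x j).take t, ((emitter H).run x t).2.length) := by
  induction t with
  | zero => rfl
  | succ t ih => simp only [Transducer.run, ih, step_emitter, List.length_append]

theorem response_emitter (t : ℕ) : (emitter H).response x t =
    (H (t + 1) fun j => (x j).take (t + 1))[((emitter H).run x t).2.length]? := by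
  rw [Transducer.response, run_emitter_fst, step_emitter]

theorem cell_eq_of_response_emitter_eq_some
    (hy : ConvergesTo (fun t => H t fun j => (x j).take t) y) {t : ℕ} {v : Option A}
    (h : (emitter H).response x t = some v) : y.cell ((emitter H).run x t).2.length = v :=
  hy.approximates (t + 1) _ _ ((response_emitter t).symm.trans h)

theorem cell_eq_of_getElem?_run_emitter
    (hy : ConvergesTo (fun t => H t fun j => (x j).take t) y) {t m : ℕ} {a : A}
    (h : ((emitter H).run x t).2[m]? = some a) : y.cell m = some a := by
  induction t with
  | zero => cases h
  | succ t ih =>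
    change (((emitter H).run x t).2 ++ ((emitter H).response x t).join.toList)[m]? = _ at h
    rcases hr : (emitter H).response x t with _ | _ | b <;>
      simp only [hr, Option.join_none, Option.join_some, Option.toList_none, Option.toList_some,
        List.append_nil] at h
    · exact ih h
    · exact ih h
    · rw [List.getElem?_append] at h
      split_ifs at h with hm
      · exact ih h
      · obtain ⟨hlen, rfl⟩ := List.getElem?_eq_some_iff.1 h
        obtain rfl : m = ((emitter H).run x t).2.length := by
          rw [List.length_singleton] at hlen
          lia
        simpa only [List.getElem_singleton] using cell_eq_of_response_emitter_eq_some hy hr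

theorem eventually_le_length_run_emitter
    (hy : ConvergesTo (fun t => H t fun j => (x j).take t) y)
    (hne : ∀ t, (emitter H).response x t ≠ some none) (m : ℕ) :
    ∀ᶠ t in atTop, m ≤ ((emitter H).run x t).2.length := by
  induction m with
  | zero => exact .of_forall fun t => Nat.zero_le _
  | succ m ih =>
    obtain ⟨T, hT⟩ := eventually_atTop.1 (ih.and (hy.eventually_lt_length m))
    refine eventually_atTop.2 ⟨T + 1, fun t ht => ?_⟩
    obtain ⟨s, rfl⟩ : ∃ s, t = s + 1 := ⟨t - 1, by lia⟩
    change m + 1 ≤ (((emitter H).run x s).2 ++ ((emitter H).response x s).join.toList).length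
    rw [List.length_append]
    rcases (hT s (by lia)).1.lt_or_eq with hlt | heq
    · lia
    · rcases hr : (emitter H).response x s with _ | _ | a
      · rw [response_emitter, ← heq, List.getElem?_eq_none_iff] at hr
        exact absurd (hT (s + 1) (by lia)).2 hr.not_gt
      · exact absurd hr (hne s)
      · exact Nat.add_le_add_right heq.le 1

end Emitter

section Machine

variable {A : Type*} {k : ℕ} {κ : Fin k → NameKind} {H : ApproxFn A k} {x : ∀ j, Names A (κ j)}

theorem exists_haltsAt_emitter {w : Names A .word}
    (hw : ConvergesTo (fun t => H t fun j => (x j).take t) w) :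
    ∃ t, (emitter H).HaltsAt x t := by
  classical
  have hhalt : ∃ t, (emitter H).response x t = some none := by
    by_contra! hne
    obtain ⟨t, ht⟩ :=
      (eventually_le_length_run_emitter hw hne (List.length (α := A) w + 1)).exists
    have cell_eq_some := cell_eq_of_getElem?_run_emitter hw (List.getElem?_eq_getElem ht)
    have cell_eq_none : w.cell (List.length (α := A) w) = none := List.getElem?_eq_none le_rfl
    exact Option.some_ne_none _ (cell_eq_some.symm.trans cell_eq_none)
  exact ⟨Nat.find hhalt, Nat.find_spec hhalt, fun s => Nat.find_min hhalt⟩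

theorem run_emitter_eq_of_haltsAt {w : Names A .word}
    (hw : ConvergesTo (fun t => H t fun j => (x j).take t) w) {t : ℕ}
    (ht : (emitter H).HaltsAt x t) : ((emitter H).run x t).2 = w := by
  have length_le : List.length (α := A) w ≤ ((emitter H).run x t).2.length :=
    List.getElem?_eq_none_iff.1 (cell_eq_of_response_emitter_eq_some hw ht.1)
  refine List.ext_getElem? fun m => ?_
  rcases lt_or_ge m ((emitter H).run x t).2.length with hm | hm
  · rw [List.getElem?_eq_getElem hm]
    exact (cell_eq_of_getElem?_run_emitter hw (List.getElem?_eq_getElem hm)).symm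
  · rw [List.getElem?_eq_none hm]
    exact (List.getElem?_eq_none (length_le.trans hm)).symm

variable [Finite A] [Primcodable A]

theorem Transducer.IsEvaluatedBy.computes {C : CodeTransducer A k}
    (hC : (emitter H).IsEvaluatedBy C) :
    ∀ {κ₀ : NameKind} {y : Names A κ₀}, ConvergesTo (fun t => H t fun j => (x j).take t) y →
      C.machine.Computes x y
  | .word, w, hw => by
    obtain ⟨t, ht⟩ := exists_haltsAt_emitter hw
    obtain ⟨c, hc, hstep, hout⟩ := hC.exists_halting_cfg ht
    exact ⟨c, hc, hstep, hout.trans (run_emitter_eq_of_haltsAt hw ht)⟩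
  | .seq, p, hp => fun m => by
    have hne (t : ℕ) : (emitter H).response x t ≠ some none := fun ht =>
      Option.some_ne_none _ (cell_eq_of_response_emitter_eq_some hp ht)
    obtain ⟨t, ht⟩ := (eventually_le_length_run_emitter hp hne (m + 1)).exists
    obtain ⟨c, hc, hout⟩ := hC.exists_reaches_output t fun s _ => hne s
    refine ⟨c, hc, ?_⟩
    rw [hout, List.getElem?_eq_getElem ht]
    exact (cell_eq_of_getElem?_run_emitter hp (List.getElem?_eq_getElem ht)).symm

theorem exists_type2Machine_of_primrec (hH : Primrec₂ H) : ∃ M : Type2Machine A k,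
    ∀ (κ : Fin k → NameKind) (κ₀ : NameKind) (x : ∀ j, Names A (κ j)) (y : Names A κ₀),
      ConvergesTo (fun t => H t fun j => (x j).take t) y → M.Computes x y :=
  let ⟨C, hC⟩ := Transducer.exists_isEvaluatedBy (primrec_step_emitter hH)
  ⟨C.machine, fun _ _ _ _ => hC.computes⟩

end Machine

/-! ## Realizations that are tracked on approximations -/

theorem exists_toMulti_eq {X Y : Type*} {F : X → Set Y} (hF : ∀ x, (F x).Subsingleton) :
    ∃ f : X →. Y, toMulti f = F := by
  classical
  refine ⟨fun x => ⟨(F x).Nonempty, Set.Nonempty.some⟩, funext fun x => Set.ext fun y => ?_⟩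
  exact ⟨fun ⟨hx, hy⟩ => hy ▸ hx.some_mem, fun hy => ⟨⟨y, hy⟩, hF x (Set.Nonempty.some_mem _) hy⟩⟩

section TrackedRealizations

variable {A : Type*} {n : ℕ} {κ : Fin n → NameKind} {κ₀ : NameKind} {Z : Fin n → Type*}
  {Z₀ : Type*} {δ : ∀ j, Names A (κ j) → Set (Z j)} {δ₀ : Names A κ₀ → Set Z₀}
  {g : (∀ j, Z j) → Set Z₀}

/-- The multi-function `g` has a realization that is tracked by some `h` such that `C n h`. This is
relative computability if `C` is primitive recursiveness and `A` is finite, and relative continuity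
if `C` is always true. -/
def HasTrackedRealization (C : ∀ n, ApproxFn A n → Prop) (δ : ∀ j, Names A (κ j) → Set (Z j))
    (δ₀ : Names A κ₀ → Set Z₀) (g : (∀ j, Z j) → Set Z₀) : Prop :=
  ∃ (f : (∀ j, Names A (κ j)) →. Names A κ₀) (h : ApproxFn A n),
    C n h ∧ Tracks h (toMulti f) ∧ Realizes δ δ₀ (toMulti f) g

theorem relComputable_iff_hasTrackedRealization [Finite A] [Primcodable A] :
    RelComputable δ δ₀ g ↔ HasTrackedRealization (fun _ h => Primrec₂ h) δ δ₀ g := by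
  constructor
  · rintro ⟨f, ⟨e, ⟨M, hM⟩, hfe⟩, hf⟩
    exact ⟨f, M.approxOutput, M.primrec_approxOutput,
      Type2Machine.tracks_approxOutput.mono fun x y hy => (hM x y).1 (hfe x y hy), hf⟩
  · rintro ⟨f, h, hprim, hfh, hf⟩
    obtain ⟨M, hM⟩ := exists_type2Machine_of_primrec hprim
    obtain ⟨e, he⟩ := exists_toMulti_eq
      (F := fun x : ∀ j, Names A (κ j) => {y : Names A κ₀ | M.Computes x y})
      fun x y hy y' hy' => Type2Machine.tracks_approxOutput.unique hy hy'
    have mem_e_iff (x y) : y ∈ e x ↔ M.Computes x y := Set.ext_iff.1 (congrFun he x) y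
    exact ⟨f, ⟨e, ⟨M, mem_e_iff⟩, fun x y hy =>
      (mem_e_iff x y).2 (hM κ κ₀ x y (hfh x y hy _ fun j => (x j).convergesTo_take))⟩, hf⟩

theorem relContinuous_iff_hasTrackedRealization :
    RelContinuous δ δ₀ g ↔ HasTrackedRealization (fun _ _ => True) δ δ₀ g :=
  ⟨fun ⟨f, hcont, hf⟩ => ⟨f, _, trivial, tracks_commonPrefix_compatibleValues hcont, hf⟩,
    fun ⟨f, _, _, hfh, hf⟩ => ⟨f, isContinuous_of_tracks hfh, hf⟩⟩

theorem Realizes.exists_inter {F : (∀ j, Names A (κ j)) →. Names A .word}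
    {f : (∀ j, Z j) →. List A} (hF : Realizes δ (idWord A) (toMulti F) (toMulti f))
    {S : Set (List A)} (hf : ∀ x, toMulti f x ⊆ S) :
    ∃ G : (∀ j, Names A (κ j)) →. List A, (∀ x, toMulti G x = toMulti F x ∩ S) ∧
      Realizes δ (idWord A) (toMulti G) (toMulti f) := by
  obtain ⟨G, hG⟩ := exists_toMulti_eq (F := fun x => toMulti F x ∩ S)
    fun x y hy y' hy' => Part.mem_unique hy.1 hy'.1
  refine ⟨G, congrFun hG, fun x y hxy hne => ?_⟩
  obtain ⟨⟨v, hv⟩, hval⟩ := hF x y hxy hne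
  obtain ⟨_, hvf, rfl⟩ := hval v hv
  rw [hG]
  exact ⟨⟨_, hv, hf y hvf⟩, fun w hw => hval w hw.1⟩

end TrackedRealizations

section Statements

variable {A : Type*} [Zero A] [One A] {Lab Γ : Type} {L : ℕ} {X : Fin (L + 1) → Type*}
  {κ : Fin (L + 1) → NameKind} {C : ∀ n, ApproxFn A n → Prop}

/-- The function in the statement, if there is one, has a realization that is tracked by some `h`
such that `C n h`. -/
def StmtHasTrackedRealization (C : ∀ n, ApproxFn A n → Prop)
    (δ : ∀ i, Names A (κ i) → Set (X i)) : Stmt A Lab Γ X → Prop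
  | .assign i _ idx f _ => HasTrackedRealization C (fun j => δ (idx j)) (δ i) f
  | .branch _ idx f _ _ _ => HasTrackedRealization C (fun j => δ (idx j)) (idWord A) (toMulti f)
  | _ => True

theorem StmtHasTrackedRealization.exists_stmt {δ : ∀ i, Names A (κ i) → Set (X i)}
    {s : Stmt A Lab Γ X} (h : StmtHasTrackedRealization C δ s) :
    ∃ (s' : Stmt A Lab Γ fun i => Names A (κ i)) (s'' : ApproxStmt A Lab Γ (L + 1)),
      StmtRealizes δ s s' ∧ StmtTracks s' s'' ∧ s''.All C := by
  cases s with
  | right i l' => exact ⟨_, _, .right i l', .right i l', trivial⟩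
  | left i l' => exact ⟨_, _, .left i l', .left i l', trivial⟩
  | write i a l' => exact ⟨_, _, .write i a l', .write i a l', trivial⟩
  | test i a l' l'' => exact ⟨_, _, .test i a l' l'', .test i a l' l'', trivial⟩
  | assign i n idx f l' =>
    obtain ⟨F, H, hC, hH, hF⟩ := h
    exact ⟨_, _, .assign i n idx f _ l' hF, .assign i n idx _ H l' hH, hC⟩
  | branch n idx f hf l' l'' =>
    obtain ⟨F, H, hC, hH, hF⟩ := h
    obtain ⟨G, hG, hGf⟩ := hF.exists_inter (S := {v | v = [0] ∨ v = [1]}) hf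
    exact ⟨_, _, .branch n idx f hf G (fun x v hv => ((hG x).le hv).2) l' l'' hGf,
      .branch n idx G _ H l' l'' (hH.mono fun x v hv => ((hG x).le hv).1), hC⟩

end Statements

namespace GTM

variable {A : Type*} [Zero A] [One A] {P : GTM A} {κ : Fin (P.L + 1) → NameKind}
  {δ : ∀ i, Names A (κ i) → Set (P.X i)}

theorem hasTrackedRealization_fn {C : ∀ n, ApproxFn A n → Prop} (h01 : (0 : A) ≠ 1)
    (h : ∀ l, StmtHasTrackedRealization C δ (P.stm l))
    (hC : ∀ hs : {l : P.Lab // l ≠ P.lf} → ApproxStmt A P.Lab P.Γ (P.L + 1),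
      (∀ l, (hs l).All C) → C P.k (P.approxResult hs)) :
    HasTrackedRealization C (fun j => δ (P.inTape j)) (δ 0) P.fn := by
  choose stm' hs hrealizes htracks hall using fun l => (h l).exists_stmt
  have htracked := tracks_approxResult h01 htracks
  obtain ⟨f, hf⟩ := exists_toMulti_eq fun x y hy y' hy' => htracked.unique (x := x) hy hy'
  refine ⟨f, P.approxResult hs, hC hs hall, ?_⟩
  rw [hf]
  exact ⟨htracked, realizes_results hrealizes⟩

theorem RelComputable.stmtHasTrackedRealization [Finite A] [Primcodable A]
    (h : P.RelComputable δ) (l) :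
    StmtHasTrackedRealization (fun _ h => Primrec₂ h) δ (P.stm l) := by
  have hl := h l
  generalize P.stm l = s at hl ⊢
  cases s with
  | right | left | write | test => trivial
  | assign | branch => exact relComputable_iff_hasTrackedRealization.1 hl

theorem RelContinuous.stmtHasTrackedRealization (h : P.RelContinuous δ) (l) :
    StmtHasTrackedRealization (fun _ _ => True) δ (P.stm l) := by
  have hl := h l
  generalize P.stm l = s at hl ⊢
  cases s with
  | right | left | write | test => trivial
  | assign | branch => exact relContinuous_iff_hasTrackedRealization.1 hl

theorem RelComputable.relComputable_fn [Finite A] (h01 : (0 : A) ≠ 1) (h : P.RelComputable δ) :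
    TTE.RelComputable (fun j => δ (P.inTape j)) (δ 0) P.fn := by
  have := P.finLab
  have := P.finΓ
  let _ : Primcodable A := primcodableOfFinite A
  let _ : Primcodable P.Lab := primcodableOfFinite P.Lab
  let _ : Primcodable P.Γ := primcodableOfFinite P.Γ
  exact relComputable_iff_hasTrackedRealization.2 (hasTrackedRealization_fn h01
    h.stmtHasTrackedRealization fun _ => P.primrec_approxResult)

theorem RelContinuous.relContinuous_fn (h01 : (0 : A) ≠ 1) (h : P.RelContinuous δ) :
    TTE.RelContinuous (fun j => δ (P.inTape j)) (δ 0) P.fn :=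
  relContinuous_iff_hasTrackedRealization.2
    (hasTrackedRealization_fn h01 h.stmtHasTrackedRealization fun _ _ => trivial)

end GTM

end TTE

theorem mainTheorem8_general {A : Type*} [Zero A] [One A] (h01 : (0 : A) ≠ 1)
    (P : TTE.GTM A) (κ : Fin (P.L + 1) → TTE.NameKind)
    (δ : ∀ i, TTE.Names A (κ i) → Set (P.X i)) :
    (Finite A → P.RelComputable δ → TTE.RelComputable (fun j => δ (P.inTape j)) (δ 0) P.fn) ∧
      (P.RelContinuous δ → TTE.RelContinuous (fun j => δ (P.inTape j)) (δ 0) P.fn) :=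
  ⟨fun _ h => h.relComputable_fn h01, fun h => h.relContinuous_fn h01⟩

theorem mainTheorem8 {A : Type*} [Finite A] [Zero A] [One A] (h01 : (0 : A) ≠ 1)
    (P : TTE.GTM A) (κ : Fin (P.L + 1) → TTE.NameKind)
    (δ : ∀ i, TTE.Names A (κ i) → Set (P.X i)) (hδ : ∀ i, TTE.IsMultiRep (δ i)) :
    (P.RelComputable δ → TTE.RelComputable (fun j => δ (P.inTape j)) (δ 0) P.fn) ∧
      (P.RelContinuous δ → TTE.RelContinuous (fun j => δ (P.inTape j)) (δ 0) P.fn) :=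
  (mainTheorem8_general h01 P κ δ).imp_left fun h => h inferInstance
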